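/- **Umbral conventions.** A (scalar) umbra $\alpha$ is a symbol with moments $E[\alpha^n]\in\mathbb R$ ($n\ge 0$, $E[\alpha^0]=1$), where $E$ is the linear evaluation functional on umbral polynomials that is multiplicative on products of powers of distinct umbrae; every unital real sequence is the moment sequence of some umbra. Its generating function is the formal power series $f(\alpha,z)=\sum_{n\ge 0}E[\alpha^n]z^n/n!$. Let $B_{i,j}$ be the partial exponential Bell polynomials and $(y)_j=y(y-1)\cdots(y-j+1)$. For $c,t\in\mathbb R$ and umbrae $\alpha,\eta$, with $a_n=E[\alpha^n]$, the auxiliary umbrae $c\alpha$, $\alpha\,\dot+\,\eta$, $t.\alpha$ and $\eta.\alpha$ are given by $E[(c\alpha)^n]=c^nE[\alpha^n]$, $f(\alpha\,\dot+\,\eta,z)=f(\alpha,z)+f(\eta,z)-1$, $E[(t.\alpha)^i]=\sum_{j=0}^{i}(t)_jB_{i,j}(a_1,a_2,\dots)$ and $E[(\eta.\alpha)^i]=\sum_{j=0}^{i}E[(\eta)_j]B_{i,j}(a_1,a_2,\dots)$. The umbrae $\chi,\beta,\delta$ have $f(\chi,z)=1+z$, $f(\beta,z)=\exp(e^z-1)$,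 $f(\delta,z)=1+z^2/2$. **Lévy processes.** A Lévy process is a real process $\{X_t\}_{t\ge 0}$ with $X_0=0$ a.s. and independent and stationary increments that is stochastically continuous. A Lévy triplet of it is $(m,s^2,\nu)$, where $m,s\in\mathbb R$ and $\nu$ is a measure on $\mathbb R$ (the Lévy measure) with $\nu(\{0\})=0$ and $\int\min(1,x^2)\,d\nu<\infty$, such that for all $u\in\mathbb R$ $$E[e^{iuX_1}]=\exp\Big\{ium-\tfrac12s^2u^2+\int_{\mathbb R}\big(e^{iux}-1-iux\mathbf 1_{\{|x|\le 1\}}\big)\,d\nu(x)\Big\}.$$ **Theorem.** Let $\{X_t\}_{t\ge0}$ be a Lévy process. Then it has a Lévy triplet. Moreover, let $(m,s^2,\nu)$ be any Lévy triplet of it such that $\nu$ has all moments, i.e. $\int|x|^n\,d\nu<\infty$ for all $n\ge 2$, put $c_0=m+\int_{\{|x|>1\}}x\,d\nu(x)$, and let $\gamma$ be the umbra with $$f(\gamma,z)=1+\int_{\mathbb R}\big(e^{zx}-1-zx\big)\,d\nu(x)$$ as a formal power series, integrated coefficientwise. Then $\{X_t\}_{t\ge 0}$ is umbrally represented by the family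 $\{t.\beta.[c_0\chi\,\dot+\,s\delta\,\dot+\,\gamma]\}_{t\ge0}$, where $t.\beta.\alpha$ means $t.(\beta.\alpha)$: for all $t\ge0$ and all integers $k\ge0$, $X_t^k$ is integrable and $$E[X_t^k]=E\big[(t.\beta.[c_0\chi\,\dot+\,s\delta\,\dot+\,\gamma])^k\big].$$ -/

import Mathlib

open MeasureTheory ProbabilityTheory Filter Topology PowerSeries
open scoped NNReal ENNReal Nat

noncomputable section

/-! ### Scalar umbral calculus -/

/-- The alphabet of (scalar) umbrae.  It is saturated: every unital real sequence is the sequence of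
moments of an umbra, and in fact of infinitely many distinct ones, which the label tells apart. -/
@[ext]
structure Umbra where
  /-- the sequence `1, a₁, a₂, …` represented by the umbra -/
  moment : ℕ → ℝ
  moment_zero : moment 0 = 1
  /-- distinguishes similar umbrae -/
  label : ℕ

namespace Umbra

/-- The evaluation functional on umbral polynomials: the linear functional that sends a monomial
`α ^ i * β ^ j * ⋯` in distinct umbrae to the product of the moments (uncorrelation property). -/
def evaluation : MvPolynomial Umbra ℝ →ₗ[ℝ] ℝ :=
  (MvPolynomial.basisMonomials Umbra ℝ).constr ℝ
    (fun d : Umbra →₀ ℕ => d.prod fun α k => α.moment k)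

theorem evaluation_monomial (d : Umbra →₀ ℕ) (c : ℝ) :
    evaluation (MvPolynomial.monomial d c) = c * d.prod fun α k => α.moment k := by
  have h : evaluation (MvPolynomial.monomial d 1) = d.prod fun α k => α.moment k := by
    have := (MvPolynomial.basisMonomials Umbra ℝ).constr_basis ℝ
      (fun d : Umbra →₀ ℕ => d.prod fun α k => α.moment k) d
    simpa [evaluation] using this
  have h2 : MvPolynomial.monomial d c = c • MvPolynomial.monomial d (1 : ℝ) := by
    simp [MvPolynomial.smul_monomial]
  rw [h2, map_smul, h, smul_eq_mul]

theorem evaluation_one : evaluation 1 = 1 := by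
  have := evaluation_monomial 0 1
  simpa using this

/-- The evaluation of the `n`-th power of an umbra is its `n`-th moment. -/
theorem evaluation_X_pow (α : Umbra) (n : ℕ) :
    evaluation (MvPolynomial.X α ^ n) = α.moment n := by
  rw [MvPolynomial.X_pow_eq_monomial, evaluation_monomial,
    Finsupp.prod_single_index α.moment_zero, one_mul]

/-- The generating function `f(α, z) = ∑ E[αⁿ] zⁿ / n!`, a formal power series. -/
def genFun (α : Umbra) : ℝ⟦X⟧ :=
  PowerSeries.mk fun n => evaluation (MvPolynomial.X α ^ n) / (n ! : ℝ)

/-- An umbra with a prescribed generating function. -/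
def ofGenFun (f : ℝ⟦X⟧) (hf : constantCoeff f = 1) : Umbra where
  moment n := (n ! : ℝ) * coeff n f
  moment_zero := by simpa using hf
  label := 0

theorem genFun_ofGenFun (f : ℝ⟦X⟧) (hf : constantCoeff f = 1) : (ofGenFun f hf).genFun = f := by
  ext n
  have : (n ! : ℝ) ≠ 0 := by positivity
  simp only [genFun, evaluation_X_pow, coeff_mk, ofGenFun]
  field_simp

theorem constantCoeff_genFun (α : Umbra) : constantCoeff α.genFun = 1 := by
  rw [← coeff_zero_eq_constantCoeff_apply]
  simp [genFun, evaluation_one]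

/-- The singleton umbra `χ`, with `f(χ, z) = 1 + z`. -/
def singleton : Umbra := ofGenFun (1 + X) (by simp)

/-- The umbra `δ`, with `f(δ, z) = 1 + z² / 2`. -/
def delta : Umbra := ofGenFun (1 + C (1 / 2 : ℝ) * X ^ 2) (by simp)

/-- The Bell umbra `β`, with `f(β, z) = exp (e ^ z - 1)`. -/
def bell : Umbra := ofGenFun ((exp ℝ).subst (exp ℝ - 1 : ℝ⟦X⟧)) (by
  have h : PowerSeries.subst (exp ℝ - 1 : ℝ⟦X⟧) (exp ℝ)
      = 1 + PowerSeries.subst (exp ℝ - 1 : ℝ⟦X⟧) (exp ℝ - 1) := by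
    rw [subst_sub (HasSubst.exp_sub_one (A := ℝ))]
    have h1 : PowerSeries.subst (exp ℝ - 1 : ℝ⟦X⟧) (1 : ℝ⟦X⟧) = 1 := by
      rw [← coe_substAlgHom (HasSubst.exp_sub_one (A := ℝ)), map_one]
    rw [h1]; ring
  have h2 : constantCoeff (PowerSeries.subst (exp ℝ - 1 : ℝ⟦X⟧) (exp ℝ - 1) : ℝ⟦X⟧) = 0 :=
    constantCoeff_subst_eq_zero (by change constantCoeff (exp ℝ - 1 : ℝ⟦X⟧) = 0; simp) _ (by simp)
  rw [h, map_add, h2]; simp)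

/-- The scalar multiple `c α`, with `E[(c α)ⁿ] = cⁿ E[αⁿ]`. -/
def scale (c : ℝ) (α : Umbra) : Umbra where
  moment n := c ^ n * evaluation (MvPolynomial.X α ^ n)
  moment_zero := by simp [evaluation_one]
  label := 0

/-- The disjoint sum `α ∔ γ`, with `f(α ∔ γ, z) = f(α, z) + f(γ, z) - 1`. -/
def disjointSum (α γ : Umbra) : Umbra :=
  ofGenFun (α.genFun + γ.genFun - 1) (by simp [constantCoeff_genFun])

/-- The value `B_{i,j}(a₁, a₂, …)` of the partial exponential Bell polynomial, i.e. the coefficient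
of `zⁱ / i!` in `(∑_{n ≥ 1} aₙ zⁿ / n!)ʲ / j!`. -/
def partialBell (i j : ℕ) (a : ℕ → ℝ) : ℝ :=
  (i ! : ℝ) / (j ! : ℝ) *
    coeff i ((PowerSeries.mk fun n => if n = 0 then 0 else a n / (n ! : ℝ)) ^ j)

theorem partialBell_zero_zero (a : ℕ → ℝ) : partialBell 0 0 a = 1 := by
  simp [partialBell]

/-- The dot-product `t . α` of a real number `t` and an umbra `α`, with
`E[(t . α)ⁱ] = ∑_j (t)_j B_{i,j}(a₁, a₂, …)`, where `aₙ = E[αⁿ]` and `(t)_j` is the lower factorial.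
(The summand `j = 0` is there for `i = 0`; it vanishes for `i ≥ 1`.) -/
def realDot (t : ℝ) (α : Umbra) : Umbra where
  moment i := ∑ j ∈ Finset.range (i + 1), (descPochhammer ℝ j).eval t *
    partialBell i j fun n => evaluation (MvPolynomial.X α ^ n)
  moment_zero := by simp [partialBell_zero_zero]
  label := 0

/-- The dot-product `γ . α` of two umbrae, with
`E[(γ . α)ⁱ] = ∑_j E[(γ)_j] B_{i,j}(a₁, a₂, …)`, where `aₙ = E[αⁿ]` and `(γ)_j` is the lower
factorial umbral polynomial `γ (γ - 1) ⋯ (γ - j + 1)`. -/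
def dot (γ α : Umbra) : Umbra where
  moment i := ∑ j ∈ Finset.range (i + 1),
    evaluation (Polynomial.aeval (MvPolynomial.X γ : MvPolynomial Umbra ℝ) (descPochhammer ℝ j)) *
      partialBell i j fun n => evaluation (MvPolynomial.X α ^ n)
  moment_zero := by simp [partialBell_zero_zero, evaluation_one]
  label := 0

/-- The formal power series `∫ (e^{z x} - 1 - z x) dν(x)` in `z`, integrated coefficientwise. -/
def levySeries (ν : Measure ℝ) : ℝ⟦X⟧ :=
  PowerSeries.mk fun n => ∫ x, coeff n (rescale x (exp ℝ) - 1 - C x * X : ℝ⟦X⟧) ∂ν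

/-- The umbra `γ` of a Lévy measure `ν`, with `f(γ, z) = 1 + ∫ (e^{z x} - 1 - z x) dν(x)`. -/
def ofLevyMeasure (ν : Measure ℝ) : Umbra :=
  ofGenFun (1 + levySeries ν) (by
    have h : constantCoeff (levySeries ν) = 0 := by
      rw [← coeff_zero_eq_constantCoeff_apply]
      simp [levySeries]
    rw [map_add, h]; simp)

end Umbra

/-! ### Lévy processes -/

/-- A real Lévy process: it starts at `0`, has independent and stationary increments and is
stochastically continuous.  (Càdlàg paths are not required; with the other properties they imply
stochastic continuity.) -/
structure IsLevyProcess {Ω : Type*} [MeasurableSpace Ω] (X : ℝ≥0 → Ω → ℝ) (P : Measure Ω) :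
    Prop where
  measurable : ∀ t, Measurable (X t)
  start : ∀ᵐ ω ∂P, X 0 ω = 0
  indep : HasIndepIncrements X P
  stationary : ∀ s h : ℝ≥0, IdentDistrib (fun ω => X (s + h) ω - X s ω) (X h) P P
  continuous : ∀ t : ℝ≥0, TendstoInMeasure P X (𝓝 t) (X t)

/-- A Lévy measure on `ℝ`: no mass at `0` and `∫ min (1, x²) dν < ∞`. -/
structure IsLevyMeasure (ν : Measure ℝ) : Prop where
  zero : ν {0} = 0
  lintegral_lt_top : ∫⁻ x, ENNReal.ofReal (min 1 (x ^ 2)) ∂ν < ∞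

/-- `(m, v, ν)` is a Lévy triplet of the process `X`, in the sense of the Lévy–Khintchine formula
`E[exp (i u X₁)] = exp (i u m - v u² / 2 + ∫ (exp (i u x) - 1 - i u x 1_{|x| ≤ 1}) dν(x))`. -/
structure IsLevyTriplet {Ω : Type*} [MeasurableSpace Ω] (X : ℝ≥0 → Ω → ℝ) (P : Measure Ω)
    (m v : ℝ) (ν : Measure ℝ) : Prop where
  nonneg : 0 ≤ v
  levyMeasure : IsLevyMeasure ν
  charFun_eq : ∀ u : ℝ, charFun (P.map (X 1)) u =
    Complex.exp (Complex.I * u * m - v * u ^ 2 / 2 +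
      ∫ x : ℝ, (Complex.exp (Complex.I * u * x) - 1 -
        Complex.I * u * ({y : ℝ | |y| ≤ 1}.indicator (fun y => y) x : ℝ)) ∂ν)

/-- The process `X` is umbrally represented by the family `α t`, `t ≥ 0`: all moments of each `X t`
are finite, and they are the moments of the umbra `α t`. -/
def IsUmbrallyRepresentedBy {Ω : Type*} [MeasurableSpace Ω] (X : ℝ≥0 → Ω → ℝ) (P : Measure Ω)
    (α : ℝ≥0 → Umbra) : Prop :=
  ∀ (t : ℝ≥0) (k : ℕ), Integrable (fun ω => X t ω ^ k) P ∧
    ∫ ω, X t ω ^ k ∂P = Umbra.evaluation (MvPolynomial.X (α t) ^ k)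

end

open scoped BoundedContinuousFunction ContDiff

/-! ### Umbral side: generating functions and the moment recursion. -/

namespace Umbra

/-! Formally, `t.β.α` has generating function `exp (t (f(α, z) - 1))`, while a Lévy process has
characteristic function `exp (t ψ(u))`. The theorem says that the Taylor coefficients of `ψ` at `0`
are, up to powers of `i`, the moments of `α = c₀χ ∔ sδ ∔ γ`. Both sides are compared through their
logarithmic derivatives: differentiating the exponential gives one and the same recursion for the
moments, on the umbral side in `moment_realDot_bell_dot_succ` and on the probabilistic side by
Leibniz' rule in `moments_of_charFun_eq_exp_levyExponent`.

The existence of `ψ` comes from the semigroup property in time (`IsLevyProcess.exists_exponent`).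
For the triplet, the laws of `X` at time `1/(n+1)` are multiplied by `(n+1)(1 - sin x / x)`. The
characteristic functions of these finite measures converge to a continuous limit, so a weak cluster
point exists. Its atom at `0` gives the Gaussian part, and the rest, divided by `1 - sin x / x`, is
the Lévy measure (`exists_levyKhintchine`).

For a given triplet with moments, the large jumps are integrable and the compensator extends to all
jumps, which turns `m` into `c₀`. The second derivative of the exponent is a constant minus the
characteristic function of the finite measure `x² dν`, hence smooth. So the characteristic function
of `X t` is smooth, and a finite measure with smooth characteristic function has all moments
(`memLp_id_of_contDiff_charFun`). The formula of a triplet only concerns time `1`; continuity of the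
exponents fixes the branch of the logarithm (`eq_zero_of_exp_eq_one`) and carries it to every `t`.
-/

theorem coeff_genFun (α : Umbra) (n : ℕ) : coeff n α.genFun = α.moment n / (n ! : ℝ) := by
  simp [genFun, evaluation_X_pow]

theorem hasSubst_genFun_sub_one (α : Umbra) : HasSubst (α.genFun - 1) :=
  HasSubst.of_constantCoeff_zero' (by simp [constantCoeff_genFun])

theorem mk_eq_genFun_sub_one (α : Umbra) :
    (PowerSeries.mk fun n => if n = 0 then 0 else
      evaluation (MvPolynomial.X α ^ n) / (n ! : ℝ)) = α.genFun - 1 := by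
  ext n
  rcases eq_or_ne n 0 with rfl | hn
  · simp [constantCoeff_genFun]
  · simp [coeff_genFun, coeff_one, hn, evaluation_X_pow]

/-- A sum against partial Bell polynomials is a coefficient of a composition of series. -/
theorem sum_mul_partialBell (c : ℕ → ℝ) (α : Umbra) (i : ℕ) :
    ∑ j ∈ Finset.range (i + 1),
        c j * partialBell i j (fun n => evaluation (MvPolynomial.X α ^ n)) =
      (i ! : ℝ) *
        coeff i ((PowerSeries.mk fun j => c j / (j ! : ℝ)).subst (α.genFun - 1) : ℝ⟦X⟧) := by
  rw [coeff_subst' α.hasSubst_genFun_sub_one,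
    finsum_eq_sum_of_support_subset (s := Finset.range (i + 1)), Finset.mul_sum]
  · refine Finset.sum_congr rfl fun j _ => ?_
    rw [partialBell, mk_eq_genFun_sub_one, coeff_mk, smul_eq_mul]
    ring
  · intro j hj
    simp only [Finset.coe_range, Set.mem_Iio]
    by_contra! hij
    refine hj ?_
    -- The `j`-th power of a series without constant term has order at least `j`, so the terms with
    -- `j > i` drop out.
    have h0 : (X : ℝ⟦X⟧) ∣ α.genFun - 1 := by
      rw [X_dvd_iff]; simp [constantCoeff_genFun]
    have h1 := X_pow_dvd_iff.1 (pow_dvd_pow_of_dvd h0 j) i (by omega)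
    simp [h1]

theorem genFun_realDot (t : ℝ) (α : Umbra) :
    (realDot t α).genFun =
      (PowerSeries.mk fun j => (descPochhammer ℝ j).eval t / (j ! : ℝ)).subst (α.genFun - 1) := by
  ext i
  have : (i ! : ℝ) ≠ 0 := by positivity
  simp only [coeff_genFun, realDot]
  rw [sum_mul_partialBell (fun j => (descPochhammer ℝ j).eval t)]
  field_simp

theorem genFun_dot (γ α : Umbra) :
    (dot γ α).genFun =
      (PowerSeries.mk fun j => evaluation
        (Polynomial.aeval (MvPolynomial.X γ : MvPolynomial Umbra ℝ) (descPochhammer ℝ j)) /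
          (j ! : ℝ)).subst (α.genFun - 1) := by
  ext i
  have : (i ! : ℝ) ≠ 0 := by positivity
  simp only [coeff_genFun, dot]
  rw [sum_mul_partialBell (fun j => evaluation
    (Polynomial.aeval (MvPolynomial.X γ : MvPolynomial Umbra ℝ) (descPochhammer ℝ j)))]
  field_simp

/-- The binomial series solves `(1 + X) B' = t B`. -/
theorem one_add_X_mul_derivative_binomial (t : ℝ) :
    (1 + X) * d⁄dX ℝ (PowerSeries.mk fun j => (descPochhammer ℝ j).eval t / (j ! : ℝ)) =
      C t * PowerSeries.mk fun j => (descPochhammer ℝ j).eval t / (j ! : ℝ) := by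
  have key (j : ℕ) : (descPochhammer ℝ (j + 1)).eval t / ((j + 1) ! : ℝ) * ((j : ℝ) + 1) =
      (t - j) * ((descPochhammer ℝ j).eval t / (j ! : ℝ)) := by
    rw [descPochhammer_succ_eval, Nat.factorial_succ]
    push_cast
    field_simp
  ext j
  rw [add_mul, one_mul, map_add, coeff_C_mul, coeff_derivative, coeff_mk, coeff_mk, key]
  cases j with
  | zero => simp
  | succ j =>
    rw [coeff_succ_X_mul, coeff_derivative, coeff_mk]
    push_cast
    ring

/-- This is the differential equation of the formal power `f(α, z) ^ t`, which never has to be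
defined: substitute `f - 1` into the equation of the binomial series and use the chain rule. -/
theorem derivative_genFun_realDot (t : ℝ) (α : Umbra) :
    α.genFun * d⁄dX ℝ (realDot t α).genFun =
      C t * (realDot t α).genFun * d⁄dX ℝ α.genFun := by
  have hs := α.hasSubst_genFun_sub_one
  have h := congrArg (PowerSeries.subst (α.genFun - 1)) (one_add_X_mul_derivative_binomial t)
  have h1 : PowerSeries.subst (α.genFun - 1) (1 + X : ℝ⟦X⟧) = α.genFun := by
    rw [← coe_substAlgHom hs, map_add, map_one, substAlgHom_X]
    ring
  have h2 : PowerSeries.subst (α.genFun - 1) (C t : ℝ⟦X⟧) = C t := subst_C t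
  rw [subst_mul hs, subst_mul hs, h1, h2] at h
  rw [genFun_realDot, derivative_subst hs, ← mul_assoc, h]
  simp

/-- The moments of the Bell umbra satisfy `E[β p(β)] = E[p(β + 1)]`. -/
theorem evaluation_aeval_bell_X_mul (p : Polynomial ℝ) :
    evaluation (Polynomial.aeval (MvPolynomial.X bell : MvPolynomial Umbra ℝ) (Polynomial.X * p)) =
      evaluation (Polynomial.aeval (MvPolynomial.X bell : MvPolynomial Umbra ℝ)
        (p.comp (Polynomial.X + 1))) := by
  -- Comparing coefficients in this equation gives the Bell number recursion, which is the claim for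
  -- monomials `p`.
  have hd : d⁄dX ℝ bell.genFun = bell.genFun * exp ℝ := by
    rw [bell, genFun_ofGenFun, derivative_subst HasSubst.exp_sub_one, derivative_exp, map_sub,
      derivative_exp]
    simp
  have hrec (n : ℕ) : bell.moment (n + 1) =
      ∑ k ∈ Finset.range (n + 1), (n.choose k : ℝ) * bell.moment k := by
    have h := congrArg (coeff n) hd
    rw [coeff_derivative, coeff_mul, coeff_genFun,
      Finset.Nat.sum_antidiagonal_eq_sum_range_succ
        (fun i j => coeff i bell.genFun * coeff j (exp ℝ))] at h
    have : bell.moment (n + 1) = (n ! : ℝ) *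
        (bell.moment (n + 1) / ((n + 1)! : ℝ) * ((n : ℝ) + 1)) := by
      rw [Nat.factorial_succ]; push_cast; field_simp
    rw [this, h, Finset.mul_sum]
    refine Finset.sum_congr rfl fun k hk => ?_
    have hk' : k ≤ n := Nat.lt_succ_iff.1 (Finset.mem_range.1 hk)
    rw [coeff_genFun, Nat.cast_choose ℝ hk']
    simp
    field_simp
  induction p using Polynomial.induction_on' with
  | add p q hp hq => simp only [mul_add, map_add, Polynomial.add_comp, hp, hq]
  | monomial n a =>
    rw [← Polynomial.C_mul_X_pow_eq_monomial]
    have hc : ∀ q : Polynomial ℝ,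
        evaluation (Polynomial.aeval (MvPolynomial.X bell : MvPolynomial Umbra ℝ)
          (Polynomial.C a * q)) =
        a * evaluation (Polynomial.aeval (MvPolynomial.X bell : MvPolynomial Umbra ℝ) q) := by
      intro q
      rw [← Polynomial.smul_eq_C_mul, map_smul, map_smul, smul_eq_mul]
    rw [Polynomial.mul_comp, Polynomial.C_comp, mul_left_comm, hc, hc, ← pow_succ',
      Polynomial.X_pow_comp, add_pow]
    congr 1
    simp only [one_pow, mul_one, map_sum, map_mul, map_pow, Polynomial.aeval_X, map_natCast]
    rw [evaluation_X_pow, hrec]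
    refine Finset.sum_congr rfl fun k _ => ?_
    rw [mul_comm (_ ^ k), ← nsmul_eq_mul (n.choose k) (MvPolynomial.X bell ^ k), map_nsmul,
      evaluation_X_pow, nsmul_eq_mul]

/-- All factorial moments of the Bell umbra are `1`. -/
theorem evaluation_descPochhammer_bell (j : ℕ) :
    evaluation (Polynomial.aeval (MvPolynomial.X bell : MvPolynomial Umbra ℝ)
      (descPochhammer ℝ j)) = 1 := by
  induction j with
  | zero => simp [evaluation_one]
  | succ j ih =>
    -- In `(β)_{j+1} = β (β - 1)_j` the shift `β ↦ β + 1` undoes the `- 1`.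
    rw [descPochhammer_succ_left, evaluation_aeval_bell_X_mul, Polynomial.comp_assoc]
    simpa using ih

/-- Since the factorial moments of `β` are all `1`, the outer series is `exp` and `f(β.α, z) = exp
(f(α, z) - 1)`. -/
theorem derivative_genFun_bell_dot (α : Umbra) :
    d⁄dX ℝ (dot bell α).genFun = (dot bell α).genFun * d⁄dX ℝ α.genFun := by
  have h : (PowerSeries.mk fun j => evaluation
      (Polynomial.aeval (MvPolynomial.X bell : MvPolynomial Umbra ℝ) (descPochhammer ℝ j)) /
        (j ! : ℝ)) = exp ℝ := by
    ext j
    simp [evaluation_descPochhammer_bell]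
  rw [genFun_dot, h, derivative_subst α.hasSubst_genFun_sub_one, derivative_exp]
  simp

/-- The generating function of `t . β . α` solves the differential equation of
`exp (t (f(α, z) - 1))`. -/
theorem derivative_genFun_realDot_bell_dot (t : ℝ) (α : Umbra) :
    d⁄dX ℝ (realDot t (dot bell α)).genFun =
      C t * d⁄dX ℝ α.genFun * (realDot t (dot bell α)).genFun := by
  have h := derivative_genFun_realDot t (dot bell α)
  rw [derivative_genFun_bell_dot] at h
  have h0 : (dot bell α).genFun ≠ 0 := fun h0 => by
    simpa [h0] using constantCoeff_genFun (dot bell α)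
  refine mul_left_cancel₀ h0 (h.trans ?_)
  ring

/-- The moment-cumulant recursion for `t . β . α`. -/
theorem moment_realDot_bell_dot_succ (t : ℝ) (α : Umbra) (k : ℕ) :
    (realDot t (dot bell α)).moment (k + 1) = t * ∑ j ∈ Finset.range (k + 1),
      (k.choose j : ℝ) * α.moment (j + 1) * (realDot t (dot bell α)).moment (k - j) := by
  set G := realDot t (dot bell α) with hG
  have h := congrArg (coeff k) (derivative_genFun_realDot_bell_dot t α)
  rw [← hG, mul_assoc, coeff_C_mul, coeff_derivative, coeff_mul, coeff_genFun,
    Finset.Nat.sum_antidiagonal_eq_sum_range_succ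
      (fun i j => coeff i (d⁄dX ℝ α.genFun) * coeff j G.genFun)] at h
  have : G.moment (k + 1) = (k ! : ℝ) * (G.moment (k + 1) / ((k + 1)! : ℝ) * ((k : ℝ) + 1)) := by
    rw [Nat.factorial_succ]; push_cast; field_simp
  rw [this, h, mul_left_comm, Finset.mul_sum]
  congr 1
  refine Finset.sum_congr rfl fun j hj => ?_
  have hj' : j ≤ k := Nat.lt_succ_iff.1 (Finset.mem_range.1 hj)
  rw [coeff_derivative, coeff_genFun, coeff_genFun, Nat.cast_choose ℝ hj', Nat.factorial_succ]
  push_cast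
  field_simp

end Umbra

/-! ### Continuous multiplicative semigroups and the characteristic exponent. -/

/-- Otherwise the primitive would vanish to the right of `0`, and so would its right derivative `F
0`. -/
theorem exists_intervalIntegral_ne_zero {F : ℝ → ℂ} (hF : Continuous F) (h0 : F 0 ≠ 0) :
    ∃ ε : ℝ, 0 < ε ∧ ∫ t in (0 : ℝ)..ε, F t ≠ 0 := by
  by_contra! h
  have hd : HasDerivWithinAt (fun x => ∫ t in (0 : ℝ)..x, F t) (F 0) (Set.Ici 0) 0 :=
    (hF.integral_hasStrictDerivAt 0 0).hasDerivAt.hasDerivWithinAt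
  have hz : HasDerivWithinAt (fun x => ∫ t in (0 : ℝ)..x, F t) 0 (Set.Ici 0) 0 := by
    refine (hasDerivWithinAt_const (0 : ℝ) (Set.Ici 0) (0 : ℂ)).congr (fun x hx => ?_) (by simp)
    rcases eq_or_lt_of_le (Set.mem_Ici.1 hx) with rfl | hx
    · simp
    · exact h x hx
  exact h0 ((uniqueDiffWithinAt_Ici (0 : ℝ)).eq_deriv _ hd hz)

/-- A continuous multiplicative semigroup of complex numbers is exponential. -/
theorem exists_eq_exp_of_multiplicative {F : ℝ → ℂ} (hF : Continuous F) (h0 : F 0 = 1)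
    (hmul : ∀ s t, 0 ≤ s → 0 ≤ t → F (s + t) = F s * F t) :
    ∃ c : ℂ, ∀ t, 0 ≤ t → F t = Complex.exp (t * c) := by
  obtain ⟨ε, hε, hI⟩ := exists_intervalIntegral_ne_zero hF (by simp [h0])
  set J := ∫ t in (0 : ℝ)..ε, F t with hJ
  -- Integrating the functional equation over `[0, ε]` shows that `F` is differentiable from the
  -- right, with `F' = c F`.
  have hFI (t : ℝ) (ht : 0 ≤ t) : F t * J = ∫ x in t..t + ε, F x := by
    rw [hJ, ← intervalIntegral.integral_const_mul]
    have : ∫ x in (0 : ℝ)..ε, F (t + x) = ∫ x in t..t + ε, F x := by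
      simp
    rw [← this]
    refine intervalIntegral.integral_congr fun x hx => ?_
    rw [Set.uIcc_of_le hε.le] at hx
    exact (hmul t x ht hx.1).symm
  set c := (F ε - 1) / J with hc
  have hder (t : ℝ) (ht : 0 ≤ t) : HasDerivWithinAt F (c * F t) (Set.Ici t) t := by
    have h1 : HasDerivAt (fun y => ∫ x in (0 : ℝ)..y, F x) (F t) t :=
      (hF.integral_hasStrictDerivAt 0 t).hasDerivAt
    have h2 : HasDerivAt (fun y => ∫ x in (0 : ℝ)..(y + ε), F x) (F (t + ε)) t :=
      ((hF.integral_hasStrictDerivAt 0 (t + ε)).hasDerivAt).comp_add_const t ε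
    have h3 := ((h2.sub h1).div_const J).hasDerivWithinAt (s := Set.Ici t)
    have h4 : (F (t + ε) - F t) / J = c * F t := by
      rw [hmul t ε ht hε.le, hc]; ring
    rw [h4] at h3
    have h5 (y : ℝ) (hy : 0 ≤ y) :
        F y = ((∫ x in (0 : ℝ)..(y + ε), F x) - ∫ x in (0 : ℝ)..y, F x) / J := by
      rw [eq_div_iff hI, hFI y hy, intervalIntegral.integral_interval_sub_left
        (hF.intervalIntegrable _ _) (hF.intervalIntegrable _ _)]
    exact h3.congr (fun y hy => h5 y (ht.trans hy)) (h5 t ht)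
  refine ⟨c, fun t ht => ?_⟩
  have hconst := constant_of_has_deriv_right_zero (a := 0) (b := t)
    (f := fun x : ℝ => F x * Complex.exp (-(x * c))) (by fun_prop) (fun x hx => by
      have he : HasDerivAt (fun x : ℝ => Complex.exp (-(x * c)))
          (Complex.exp (-(x * c)) * (-(1 * c))) x :=
        (((Complex.ofRealCLM.hasDerivAt).mul_const c).neg).cexp
      have := (hder x hx.1).mul he.hasDerivWithinAt
      refine this.congr_deriv ?_
      ring) t ⟨ht, le_rfl⟩
  simp only [h0, Complex.ofReal_zero, zero_mul, neg_zero, Complex.exp_zero, mul_one,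
    Complex.exp_neg] at hconst
  rwa [← div_eq_mul_inv, div_eq_one_iff_eq (Complex.exp_ne_zero _)] at hconst

/-- Recovers the exponent `c` from `F` without choosing a logarithm; the continuity of the
characteristic exponent rests on this. -/
theorem mul_intervalIntegral_of_eq_exp {F : ℝ → ℂ} {c : ℂ}
    (h : ∀ t, 0 ≤ t → F t = Complex.exp (t * c)) {ε : ℝ} (hε : 0 ≤ ε) :
    c * ∫ t in (0 : ℝ)..ε, F t = F ε - 1 := by
  have h1 : ∫ t in (0 : ℝ)..ε, c * F t = ∫ t in (0 : ℝ)..ε, Complex.exp (t * c) * (1 * c) := by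
    refine intervalIntegral.integral_congr fun x hx => ?_
    rw [Set.uIcc_of_le hε] at hx
    rw [h x hx.1, one_mul, mul_comm]
  have h2 (x : ℝ) : HasDerivAt (fun x : ℝ => Complex.exp (x * c))
      (Complex.exp (x * c) * (1 * c)) x :=
    ((Complex.ofRealCLM.hasDerivAt).mul_const c).cexp
  rw [← intervalIntegral.integral_const_mul, h1, intervalIntegral.integral_eq_sub_of_hasDerivAt
    (fun x _ => h2 x) (Continuous.intervalIntegrable (by fun_prop) _ _), h ε hε]
  simp

namespace IsLevyProcess

variable {Ω : Type*} [MeasurableSpace Ω] {P : Measure Ω} [IsProbabilityMeasure P]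
  {X : ℝ≥0 → Ω → ℝ}

theorem charFun_zero_time (hX : IsLevyProcess X P) (u : ℝ) : charFun (P.map (X 0)) u = 1 := by
  have : P.map (X 0) = P.map (fun _ => (0 : ℝ)) := Measure.map_congr hX.start
  rw [this, Measure.map_const]
  simp

theorem charFun_add_time (hX : IsLevyProcess X P) (s t : ℝ≥0) (u : ℝ) :
    charFun (P.map (X (s + t))) u = charFun (P.map (X s)) u * charFun (P.map (X t)) u := by
  have hm := hX.measurable
  have hi := hX.indep.indepFun_eval_sub (zero_le : (0 : ℝ≥0) ≤ s) (le_self_add : s ≤ s + t) hX.start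
  have h := hi.charFun_map_add_eq_mul (hm s).aemeasurable
    ((hm (s + t)).sub (hm s)).aemeasurable
  have h2 : P.map (X (s + t) - X s) = P.map (X t) := (hX.stationary s t).map_eq
  rw [h2, add_sub_cancel] at h
  exact congrFun h u

/-- Stochastic continuity gives convergence in distribution, tested here on `x ↦ exp (iux)`. -/
theorem continuous_charFun_time (hX : IsLevyProcess X P) (u : ℝ) :
    Continuous fun t => charFun (P.map (X t)) u := by
  refine continuous_iff_continuousAt.2 fun t => ?_
  have hm := hX.measurable
  have h := ((hX.continuous t).tendstoInDistribution_of_aemeasurable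
    (fun s => (hm s).aemeasurable) (hm t).aemeasurable).tendsto
  have := (ProbabilityMeasure.tendsto_iff_forall_integral_rclike_tendsto ℂ).1 h
    (BoundedContinuousFunction.innerProbChar u)
  simp only [← charFun_eq_integral_innerProbChar] at this
  exact this

/-- The characteristic exponent of a Lévy process. -/
theorem exists_exponent (hX : IsLevyProcess X P) :
    ∃ ψ : ℝ → ℂ, Continuous ψ ∧ ψ 0 = 0 ∧
      ∀ (t : ℝ≥0) (u : ℝ), charFun (P.map (X t)) u = Complex.exp (t * ψ u) := by
  have hp (t : ℝ≥0) : IsProbabilityMeasure (P.map (X t)) :=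
    Measure.isProbabilityMeasure_map (hX.measurable t).aemeasurable
  -- Negative times are frozen at time `0`, which keeps `F u` continuous on the whole line.
  set F : ℝ → ℝ → ℂ := fun u t => charFun (P.map (X t.toNNReal)) u with hFdef
  have hF (u : ℝ) : Continuous (F u) := (hX.continuous_charFun_time u).comp continuous_real_toNNReal
  have hF0 (u : ℝ) : F u 0 = 1 := by simp [hFdef, hX.charFun_zero_time]
  have hex (u : ℝ) := exists_eq_exp_of_multiplicative (hF u) (hF0 u) (fun s t hs ht => by
    simp only [hFdef, Real.toNNReal_add hs ht, hX.charFun_add_time])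
  choose ψ hψ using hex
  refine ⟨ψ, ?_, ?_, fun t u => ?_⟩
  · refine continuous_iff_continuousAt.2 fun u => ?_
    obtain ⟨ε, hε, hne⟩ := exists_intervalIntegral_ne_zero (hF u) (by simp [hF0])
    have hc : Continuous fun v => ∫ t in (0 : ℝ)..ε, F v t := by
      refine intervalIntegral.continuous_of_dominated_interval (bound := fun _ => 1)
        (fun v => (hF v).aestronglyMeasurable) (fun v => ?_) intervalIntegrable_const ?_
      · exact ae_of_all _ fun t _ => norm_charFun_le_one v
      · exact ae_of_all _ fun t _ => continuous_charFun
    have hcε : Continuous fun v => F v ε - 1 :=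
      (continuous_charFun (μ := P.map (X ε.toNNReal))).sub continuous_const
    -- Near `u`, with the same `ε`, this quotient is `ψ v`.
    have hq : ContinuousAt (fun v => (F v ε - 1) / ∫ t in (0 : ℝ)..ε, F v t) u :=
      hcε.continuousAt.div hc.continuousAt hne
    refine hq.congr ?_
    filter_upwards [hc.continuousAt.eventually_ne hne] with v hv
    rw [div_eq_iff hv, mul_intervalIntegral_of_eq_exp (hψ v) hε.le]
  · obtain ⟨ε, hε, hne⟩ := exists_intervalIntegral_ne_zero (hF 0) (by simp [hF0])
    have h := mul_intervalIntegral_of_eq_exp (hψ 0) hε.le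
    have h1 : F 0 ε = 1 := by simp [hFdef]
    rw [h1, sub_self] at h
    exact (mul_eq_zero.1 h).resolve_right hne
  · have := hψ u t t.coe_nonneg
    simpa [hFdef] using this

end IsLevyProcess

/-! ### The weight `1 - sin x / x` and the Lévy–Khintchine integrand. -/

noncomputable section

/-- The function `1 - sin x / x`, which is comparable to `min 1 x²`. -/
def sincDefect (x : ℝ) : ℝ := 1 - Real.sinc x

/-- Truncation of a real number to the interval `[-1, 1]`. -/
def clampUnit (x : ℝ) : ℝ := max (-1) (min 1 x)

/-- The integrand of the Lévy–Khintchine formula with a continuous truncation. -/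
def levyIntegrand (u x : ℝ) : ℂ :=
  Complex.exp (Complex.I * u * x) - 1 - Complex.I * u * (clampUnit x : ℝ)

/-- The quotient of `levyIntegrand u` by `sincDefect`, extended continuously to `0`. -/
def levyQuotient (u : ℝ) : ℝ → ℂ :=
  Function.update (fun x => levyIntegrand u x / (sincDefect x : ℂ)) 0 (-3 * (u : ℂ) ^ 2)

end

@[fun_prop]
theorem continuous_sincDefect : Continuous sincDefect :=
  continuous_const.sub Real.continuous_sinc

@[fun_prop]
theorem continuous_clampUnit : Continuous clampUnit := by
  unfold clampUnit; fun_prop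

@[fun_prop]
theorem continuous_levyIntegrand (u : ℝ) : Continuous (levyIntegrand u) := by
  unfold levyIntegrand; fun_prop

theorem sincDefect_nonneg (x : ℝ) : 0 ≤ sincDefect x := sub_nonneg.2 (Real.sinc_le_one x)

theorem sincDefect_le_two (x : ℝ) : sincDefect x ≤ 2 := by
  have := Real.neg_one_le_sinc x
  unfold sincDefect; linarith

theorem abs_clampUnit_le (x : ℝ) : |clampUnit x| ≤ 1 :=
  abs_le.2 ⟨le_max_left _ _, max_le (by norm_num) (min_le_left _ _)⟩

theorem clampUnit_of_abs_le {x : ℝ} (hx : |x| ≤ 1) : clampUnit x = x := by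
  obtain ⟨h1, h2⟩ := abs_le.1 hx
  rw [clampUnit, min_eq_right h2, max_eq_right h1]

theorem abs_sincDefect_sub_le {x : ℝ} (hx : |x| ≤ 1) :
    |sincDefect x - x ^ 2 / 6| ≤ |x| ^ 4 / 100 := by
  rcases eq_or_ne x 0 with rfl | h0
  · simp [sincDefect]
  have h := Real.sin_bound hx
  have h1 : sincDefect x - x ^ 2 / 6 = -(Real.sin x - (x - x ^ 3 / 6)) / x := by
    rw [sincDefect, Real.sinc_of_ne_zero h0]
    field_simp
    ring
  have hpos : 0 < |x| := abs_pos.2 h0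
  rw [h1, abs_div, abs_neg, div_le_iff₀ hpos]
  calc _ ≤ _ := h
    _ = _ := by ring

theorem sq_le_sincDefect {x : ℝ} (hx : |x| ≤ 1) : x ^ 2 / 10 ≤ sincDefect x := by
  have h := (abs_le.1 (abs_sincDefect_sub_le hx)).1
  have h2 : |x| ^ 4 ≤ x ^ 2 := by
    rw [← sq_abs x]
    exact pow_le_pow_of_le_one (abs_nonneg x) hx (by norm_num)
  nlinarith [sq_nonneg x]

/-- Taylor expansion handles `|x| ≤ 1`, and `|sinc x| ≤ 1/|x|` handles `|x| > 2`. In between,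
halving the angle gives `sinc x ≤ sinc (x/2)`, and the quadratic bound at `x/2` yields `x²/40`,
whence the constant. -/
theorem min_le_sincDefect (x : ℝ) : min 1 (x ^ 2) ≤ 40 * sincDefect x := by
  rcases le_or_gt |x| 1 with hx | hx
  · have := sq_le_sincDefect hx
    have := sq_nonneg x
    have := min_le_right 1 (x ^ 2)
    linarith
  have hx0 : x ≠ 0 := fun h => by simp [h] at hx; linarith
  refine (min_le_left _ _).trans ?_
  rcases le_or_gt |x| 2 with hx2 | hx2
  · have hy : |x / 2| ≤ 1 := by
      rw [abs_div, abs_two]; linarith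
    have h1 := sq_le_sincDefect hy
    have h2 : Real.sinc x ≤ Real.sinc (x / 2) := by
      have hs : Real.sinc x = Real.sinc (x / 2) * Real.cos (x / 2) := by
        rw [Real.sinc_of_ne_zero hx0, Real.sinc_of_ne_zero (by simpa using hx0)]
        have : Real.sin x = 2 * Real.sin (x / 2) * Real.cos (x / 2) := by
          rw [← Real.sin_two_mul]; ring_nf
        rw [this]; field_simp
      have hp : 0 ≤ Real.sinc (x / 2) := by
        have := (abs_le.1 (abs_sincDefect_sub_le hy)).2
        have h4 : |x / 2| ^ 4 ≤ 1 := pow_le_one₀ (abs_nonneg _) hy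
        have h5 : (x / 2) ^ 2 ≤ 1 := by
          rw [← sq_abs]; exact pow_le_one₀ (abs_nonneg _) hy
        unfold sincDefect at this
        linarith
      rw [hs]
      exact mul_le_of_le_one_right hp (Real.cos_le_one _)
    have h3 : 1 ≤ x ^ 2 := by rw [← sq_abs]; exact one_le_pow₀ hx.le
    unfold sincDefect at h1 ⊢
    nlinarith
  · have h1 := Real.sinc_le_inv_abs hx0
    have h2 : |x|⁻¹ ≤ 2⁻¹ := inv_anti₀ (by norm_num) hx2.le
    unfold sincDefect
    linarith

theorem sincDefect_pos {x : ℝ} (hx : x ≠ 0) : 0 < sincDefect x := by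
  have h := min_le_sincDefect x
  have : 0 < min 1 (x ^ 2) := lt_min one_pos (by positivity)
  linarith

theorem norm_levyIntegrand_le_sq (u x : ℝ) (hx : |x| ≤ 1) :
    ‖levyIntegrand u x‖ ≤ u ^ 2 * Real.exp |u| * x ^ 2 := by
  have h := Complex.norm_exp_sub_sum_le_norm_mul_exp (Complex.I * u * x) 2
  have hn : ‖Complex.I * u * x‖ = |u| * |x| := by simp
  simp only [Finset.sum_range_succ, Finset.sum_range_zero, hn] at h
  rw [levyIntegrand, clampUnit_of_abs_le hx]
  calc _ = ‖Complex.exp (Complex.I * u * x) - (0 + (Complex.I * u * x) ^ 0 / (0 ! : ℕ) +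
        (Complex.I * u * x) ^ 1 / (1 ! : ℕ))‖ := by congr 1; simp; ring
    _ ≤ (|u| * |x|) ^ 2 * Real.exp (|u| * |x|) := h
    _ ≤ (|u| * |x|) ^ 2 * Real.exp |u| := by
      gcongr; exact mul_le_of_le_one_right (abs_nonneg u) hx
    _ = _ := by rw [mul_pow, sq_abs, sq_abs]; ring

/-- The quadratic term is isolated because it determines the value of `levyQuotient u` at `0`. -/
theorem norm_levyIntegrand_add_sq_le (u x : ℝ) (hx : |x| ≤ 1) :
    ‖levyIntegrand u x + (u : ℂ) ^ 2 * x ^ 2 / 2‖ ≤ |u| ^ 3 * Real.exp |u| * |x| ^ 3 := by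
  have h := Complex.norm_exp_sub_sum_le_norm_mul_exp (Complex.I * u * x) 3
  have hn : ‖Complex.I * u * x‖ = |u| * |x| := by simp
  simp only [Finset.sum_range_succ, Finset.sum_range_zero, hn] at h
  rw [levyIntegrand, clampUnit_of_abs_le hx]
  calc _ = ‖Complex.exp (Complex.I * u * x) - (0 + (Complex.I * u * x) ^ 0 / (0 ! : ℕ) +
        (Complex.I * u * x) ^ 1 / (1 ! : ℕ) + (Complex.I * u * x) ^ 2 / (2 ! : ℕ))‖ := by
        congr 1; simp [mul_pow]; ring
    _ ≤ (|u| * |x|) ^ 3 * Real.exp (|u| * |x|) := h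
    _ ≤ (|u| * |x|) ^ 3 * Real.exp |u| := by
      gcongr; exact mul_le_of_le_one_right (abs_nonneg u) hx
    _ = _ := by rw [mul_pow]; ring

theorem norm_levyIntegrand_le (u x : ℝ) :
    ‖levyIntegrand u x‖ ≤ (u ^ 2 * Real.exp |u| + 2 + |u|) * min 1 (x ^ 2) := by
  rcases le_or_gt |x| 1 with hx | hx
  · have h1 : x ^ 2 ≤ 1 := by rw [← sq_abs]; exact pow_le_one₀ (abs_nonneg _) hx
    rw [min_eq_right h1]
    refine (norm_levyIntegrand_le_sq u x hx).trans ?_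
    gcongr
    linarith [abs_nonneg u]
  · have h1 : 1 ≤ x ^ 2 := by rw [← sq_abs]; exact one_le_pow₀ hx.le
    rw [min_eq_left h1, mul_one, levyIntegrand]
    have h2 : ‖Complex.exp (Complex.I * u * x)‖ = 1 := by
      rw [mul_assoc, ← Complex.ofReal_mul, Complex.norm_exp_I_mul_ofReal]
    have h3 : ‖Complex.I * u * (clampUnit x : ℝ)‖ ≤ |u| := by
      simpa using mul_le_of_le_one_right (abs_nonneg u) (abs_clampUnit_le x)
    have h4 := norm_sub_le (Complex.exp (Complex.I * u * x) - 1)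
      (Complex.I * u * (clampUnit x : ℝ))
    have h5 := norm_sub_le (Complex.exp (Complex.I * u * x)) 1
    rw [norm_one, h2] at h5
    have : 0 ≤ u ^ 2 * Real.exp |u| := by positivity
    linarith

theorem sincDefect_mul_levyQuotient (u x : ℝ) :
    (sincDefect x : ℂ) * levyQuotient u x = levyIntegrand u x := by
  rcases eq_or_ne x 0 with rfl | hx
  · simp [sincDefect, levyIntegrand, clampUnit]
  · have : (sincDefect x : ℂ) ≠ 0 := Complex.ofReal_ne_zero.2 (sincDefect_pos hx).ne'
    rw [levyQuotient, Function.update_of_ne hx]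
    field_simp

theorem norm_levyQuotient_le (u x : ℝ) :
    ‖levyQuotient u x‖ ≤ 40 * (u ^ 2 * Real.exp |u| + 2 + |u|) + 3 * u ^ 2 := by
  rcases eq_or_ne x 0 with rfl | hx
  · simp only [levyQuotient, Function.update_self]
    have : ‖(-3 * (u : ℂ) ^ 2)‖ = 3 * u ^ 2 := by simp
    rw [this]
    have : 0 ≤ u ^ 2 * Real.exp |u| := by positivity
    linarith [abs_nonneg u]
  · have hp := sincDefect_pos hx
    rw [levyQuotient, Function.update_of_ne hx, norm_div, Complex.norm_real, Real.norm_eq_abs,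
      abs_of_pos hp]
    have hC : 0 ≤ u ^ 2 * Real.exp |u| + 2 + |u| := by positivity
    have : ‖levyIntegrand u x‖ / sincDefect x ≤ 40 * (u ^ 2 * Real.exp |u| + 2 + |u|) := by
      rw [div_le_iff₀ hp]
      refine (norm_levyIntegrand_le u x).trans ?_
      have := mul_le_mul_of_nonneg_left (min_le_sincDefect x) hC
      linarith
    linarith [sq_nonneg u]

theorem continuous_levyQuotient (u : ℝ) : Continuous (levyQuotient u) := by
  refine continuous_iff_continuousAt.2 fun x => ?_
  rcases eq_or_ne x 0 with rfl | hx
  · rw [levyQuotient, continuousAt_update_same]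
    have hsmall : ∀ᶠ x : ℝ in 𝓝[≠] 0, |x| ≤ 1 ∧ x ≠ 0 := by
      refine (Filter.Eventually.filter_mono nhdsWithin_le_nhds ?_).and self_mem_nhdsWithin
      filter_upwards [Metric.closedBall_mem_nhds (0 : ℝ) one_pos] with x hx
      simpa using hx
    have h1 : Tendsto (fun x : ℝ => levyIntegrand u x / (x : ℂ) ^ 2) (𝓝[≠] 0)
        (𝓝 (-(u : ℂ) ^ 2 / 2)) := by
      rw [tendsto_iff_norm_sub_tendsto_zero]
      have hb : Tendsto (fun x : ℝ => |u| ^ 3 * Real.exp |u| * |x|) (𝓝[≠] 0) (𝓝 0) := by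
        have : Tendsto (fun x : ℝ => |u| ^ 3 * Real.exp |u| * |x|) (𝓝 0)
            (𝓝 (|u| ^ 3 * Real.exp |u| * |0|)) := Continuous.tendsto (by fun_prop) 0
        simpa using this.mono_left nhdsWithin_le_nhds
      refine squeeze_zero' (Eventually.of_forall fun _ => norm_nonneg _) ?_ hb
      filter_upwards [hsmall] with x ⟨hx, h0⟩
      have h0' : (x : ℂ) ≠ 0 := Complex.ofReal_ne_zero.2 h0
      have : levyIntegrand u x / (x : ℂ) ^ 2 - -(u : ℂ) ^ 2 / 2 =
          (levyIntegrand u x + (u : ℂ) ^ 2 * x ^ 2 / 2) / (x : ℂ) ^ 2 := by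
        field_simp; ring
      rw [this, norm_div, norm_pow, Complex.norm_real, Real.norm_eq_abs,
        div_le_iff₀ (by positivity)]
      refine (norm_levyIntegrand_add_sq_le u x hx).trans (le_of_eq ?_)
      ring
    have h2 : Tendsto (fun x : ℝ => sincDefect x / x ^ 2) (𝓝[≠] 0) (𝓝 (1 / 6)) := by
      rw [tendsto_iff_norm_sub_tendsto_zero]
      have hb : Tendsto (fun x : ℝ => |x| ^ 2 / 100) (𝓝[≠] 0) (𝓝 0) := by
        have : Tendsto (fun x : ℝ => |x| ^ 2 / 100) (𝓝 0) (𝓝 (|0| ^ 2 / 100)) :=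
          Continuous.tendsto (by fun_prop) 0
        simpa using this.mono_left nhdsWithin_le_nhds
      refine squeeze_zero' (Eventually.of_forall fun _ => norm_nonneg _) ?_ hb
      filter_upwards [hsmall] with x ⟨hx, h0⟩
      have : sincDefect x / x ^ 2 - 1 / 6 = (sincDefect x - x ^ 2 / 6) / x ^ 2 := by
        field_simp
      rw [this, Real.norm_eq_abs, abs_div, abs_pow, div_le_iff₀ (by positivity)]
      refine (abs_sincDefect_sub_le hx).trans (le_of_eq ?_)
      ring
    have h2' : Tendsto (fun x : ℝ => ((sincDefect x / x ^ 2 : ℝ) : ℂ)) (𝓝[≠] 0)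
        (𝓝 ((1 / 6 : ℝ) : ℂ)) :=
      (Complex.continuous_ofReal.tendsto _).comp h2
    have h3 := h1.div h2' (by norm_num)
    -- Near `0` the integrand is `-u²x²/2` and the weight is `x²/6`, to leading order.
    have h4 : -(u : ℂ) ^ 2 / 2 / ((1 / 6 : ℝ) : ℂ) = -3 * (u : ℂ) ^ 2 := by
      push_cast; ring
    rw [h4] at h3
    refine h3.congr' ?_
    filter_upwards [hsmall] with x ⟨hx, h0⟩
    have h0' : (x : ℂ) ≠ 0 := Complex.ofReal_ne_zero.2 h0
    have : (sincDefect x : ℂ) ≠ 0 := Complex.ofReal_ne_zero.2 (sincDefect_pos h0).ne'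
    simp only [Pi.div_apply]
    push_cast
    field_simp
  · rw [levyQuotient, continuousAt_update_of_ne hx]
    exact (continuous_levyIntegrand u).continuousAt.div
      (Complex.continuous_ofReal.comp continuous_sincDefect).continuousAt
      (Complex.ofReal_ne_zero.2 (sincDefect_pos hx).ne')

/-! ### Weak compactness and existence of a Lévy triplet. -/

/-- Finite measures whose characteristic functions converge pointwise to a function that is
continuous at `0` have a weak cluster point. -/
theorem exists_ultrafilter_tendsto_integral {G : ℕ → Measure ℝ} [∀ n, IsFiniteMeasure (G n)]
    {f : ℝ → ℂ} (hf : ContinuousAt f 0)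
    (h : ∀ u, Tendsto (fun n => charFun (G n) u) atTop (𝓝 (f u))) :
    ∃ (U : Ultrafilter ℕ) (G' : Measure ℝ), (U : Filter ℕ) ≤ atTop ∧ IsFiniteMeasure G' ∧
      ∀ g : ℝ →ᵇ ℂ, Tendsto (fun n => ∫ x, g x ∂(G n)) U (𝓝 (∫ x, g x ∂G')) := by
  let F : ℕ → FiniteMeasure ℝ := fun n => ⟨G n, inferInstance⟩
  let Q : ℕ → ProbabilityMeasure ℝ := fun n => (F n).normalize
  have hGQ (n : ℕ) (g : ℝ → ℂ) :
      ∫ x, g x ∂(G n) = ((G n).real Set.univ : ℂ) * ∫ x, g x ∂(Q n : Measure ℝ) := by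
    have h1 := congrArg (fun μ : FiniteMeasure ℝ => (μ : Measure ℝ))
      (F n).self_eq_mass_smul_normalize
    have h2 : G n = (F n).mass • (Q n : Measure ℝ) := h1
    conv_lhs => rw [h2]
    rw [integral_smul_nnreal_measure, NNReal.smul_def, Complex.real_smul]
    rfl
  have hmass : Tendsto (fun n => ((G n).real Set.univ : ℂ)) atTop (𝓝 (f 0)) := by
    simpa only [charFun_zero] using h 0
  -- `f 0` is the limit of the total masses. If it vanishes, normalizing is useless and the limit is
  -- the zero measure.
  by_cases hf0 : f 0 = 0
  · refine ⟨hyperfilter ℕ, 0, Nat.hyperfilter_le_atTop, inferInstance, fun g => ?_⟩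
    rw [integral_zero_measure]
    refine Tendsto.mono_left ?_ Nat.hyperfilter_le_atTop
    have hm := hmass.norm.mul_const ‖g‖
    rw [hf0, norm_zero, zero_mul] at hm
    refine squeeze_zero_norm (fun n => ?_) hm
    refine (g.norm_integral_le_mul_norm (μ := G n)).trans ?_
    rw [Complex.norm_real, Real.norm_eq_abs, abs_of_nonneg measureReal_nonneg]
  have hQf (u : ℝ) : Tendsto (fun n => charFun (Q n : Measure ℝ) u) atTop (𝓝 (f u / f 0)) := by
    refine ((h u).div hmass hf0).congr' ?_
    filter_upwards [hmass.eventually_ne hf0] with n hn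
    simp only [Pi.div_apply]
    rw [div_eq_iff hn, charFun_apply, hGQ n, charFun_apply, mul_comm]
  -- Continuity of the limit at `0` forces tightness; Prokhorov's theorem then gives a limit along
  -- an ultrafilter.
  have htight : IsTightMeasureSet (Set.range fun n => (Q n : Measure ℝ)) :=
    isTightMeasureSet_of_tendsto_charFun (f := fun u => f u / f 0) (hf.div_const _) hQf
  have hcompact : IsCompact (closure (Set.range Q)) :=
    isCompact_closure_of_isTightMeasureSet (by simpa [Set.range] using htight)
  obtain ⟨Q', -, hQ' : Tendsto _ _ _⟩ := hcompact.ultrafilter_le_nhds ((hyperfilter ℕ).map Q)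
    (.trans (by simp) (monotone_principal subset_closure))
  have hre : Tendsto (fun n => (G n).real Set.univ) atTop (𝓝 (f 0).re) :=
    ((Complex.continuous_re.tendsto _).comp hmass).congr fun n => Complex.ofReal_re _
  have hre0 : 0 ≤ (f 0).re := ge_of_tendsto' hre fun n => measureReal_nonneg
  have hfre : ((f 0).re : ℂ) = f 0 :=
    tendsto_nhds_unique ((Complex.continuous_ofReal.tendsto _).comp hre) hmass
  refine ⟨hyperfilter ℕ, (f 0).re.toNNReal • (Q' : Measure ℝ), Nat.hyperfilter_le_atTop,
    inferInstance, fun g => ?_⟩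
  have hQ'' : Tendsto Q (hyperfilter ℕ : Filter ℕ) (𝓝 Q') := hQ'
  have hg := (ProbabilityMeasure.tendsto_iff_forall_integral_rclike_tendsto ℂ).1 hQ'' g
  have := (hmass.mono_left Nat.hyperfilter_le_atTop).mul hg
  rw [integral_smul_nnreal_measure, NNReal.smul_def, Complex.real_smul, Real.coe_toNNReal _ hre0,
    hfre]
  exact this.congr fun n => (hGQ n g).symm

theorem intervalIntegral_exp_mul_I (x : ℝ) :
    ∫ h in (-1 : ℝ)..1, Complex.exp (h * x * Complex.I) = 2 * (Real.sinc x : ℂ) := by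
  have h := integral_charFun_Icc (μ := Measure.dirac x) one_pos
  simpa [charFun_apply_real] using h

/-- `sinc x` is the mean of `exp (ihx)` over `h ∈ [-1, 1]`, so by Fubini the weight `sinc` averages
the characteristic function over shifts. -/
theorem integral_sinc_mul_exp {μ : Measure ℝ} [IsFiniteMeasure μ] (u : ℝ) :
    ∫ x, (Real.sinc x : ℂ) * Complex.exp (u * x * Complex.I) ∂μ =
      2⁻¹ * ∫ h in (-1 : ℝ)..1, charFun μ (u + h) := by
  have h1 : ∫ h in (-1 : ℝ)..1, charFun μ (u + h) =
      ∫ x, (∫ h in (-1 : ℝ)..1, Complex.exp ((u + h : ℝ) * x * Complex.I)) ∂μ := by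
    simp_rw [charFun_apply_real]
    refine intervalIntegral_integral_swap ?_
    have hc : Continuous (Function.uncurry fun (h x : ℝ) =>
        Complex.exp ((u + h : ℝ) * x * Complex.I)) := by
      unfold Function.uncurry; fun_prop
    have : IsFiniteMeasure (volume.restrict (Set.uIoc (-1 : ℝ) 1)) := by
      rw [Set.uIoc_of_le (by norm_num)]; infer_instance
    refine Integrable.of_bound (C := 1) hc.aestronglyMeasurable (ae_of_all _ fun p => ?_)
    simp only [Function.uncurry]
    rw [← Complex.ofReal_mul, Complex.norm_exp_ofReal_mul_I]
  rw [h1, ← integral_const_mul]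
  congr with x
  have h2 (h : ℝ) : Complex.exp ((u + h : ℝ) * x * Complex.I) =
      Complex.exp (u * x * Complex.I) * Complex.exp (h * x * Complex.I) := by
    rw [← Complex.exp_add]; push_cast; ring_nf
  simp_rw [h2]
  rw [intervalIntegral.integral_const_mul, intervalIntegral_exp_mul_I]
  ring

/-- The bound is uniform in `n`, as dominated convergence requires. -/
theorem norm_natCast_mul_exp_sub_one_le (z : ℂ) (n : ℕ) :
    ‖((n : ℂ) + 1) * (Complex.exp (z / (n + 1)) - 1)‖ ≤ ‖z‖ * Real.exp ‖z‖ := by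
  have h := Complex.norm_exp_sub_sum_le_norm_mul_exp (z / (n + 1)) 1
  simp only [Finset.sum_range_one, pow_zero, Nat.factorial_zero, Nat.cast_one, div_one,
    pow_one] at h
  have hn : ‖((n : ℂ) + 1)‖ = n + 1 := by
    rw [← Nat.cast_add_one, Complex.norm_natCast]; push_cast; rfl
  rw [norm_div, hn] at h
  have hle : ‖z‖ / (n + 1) ≤ ‖z‖ := div_le_self (norm_nonneg _) (by simp)
  have hpos : (0 : ℝ) < n + 1 := by positivity
  rw [norm_mul, hn]
  calc _ ≤ ((n : ℝ) + 1) * (‖z‖ / (n + 1) * Real.exp (‖z‖ / (n + 1))) := by gcongr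
    _ = ‖z‖ * Real.exp (‖z‖ / (n + 1)) := by field_simp
    _ ≤ _ := by gcongr

theorem tendsto_natCast_mul_exp_sub_one (z : ℂ) :
    Tendsto (fun n : ℕ => ((n : ℂ) + 1) * (Complex.exp (z / (n + 1)) - 1)) atTop (𝓝 z) := by
  rw [tendsto_iff_norm_sub_tendsto_zero]
  have hlim : Tendsto (fun n : ℕ => ‖z‖ ^ 2 * Real.exp ‖z‖ * (1 / ((n : ℝ) + 1))) atTop (𝓝 0) := by
    simpa using tendsto_one_div_add_atTop_nhds_zero_nat.const_mul (‖z‖ ^ 2 * Real.exp ‖z‖)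
  refine squeeze_zero (fun _ => norm_nonneg _) (fun n => ?_) hlim
  have h := Complex.norm_exp_sub_sum_le_norm_mul_exp (z / (n + 1)) 2
  simp only [Finset.sum_range_succ, Finset.sum_range_zero, pow_zero, Nat.factorial_zero,
    Nat.cast_one, div_one, pow_one, Nat.factorial_one, zero_add] at h
  have hn : ‖((n : ℂ) + 1)‖ = n + 1 := by
    rw [← Nat.cast_add_one, Complex.norm_natCast]; push_cast; rfl
  have hn0 : ((n : ℂ) + 1) ≠ 0 := Nat.cast_add_one_ne_zero n
  rw [norm_div, hn] at h
  have hle : ‖z‖ / (n + 1) ≤ ‖z‖ := div_le_self (norm_nonneg _) (by simp)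
  have hpos : (0 : ℝ) < n + 1 := by positivity
  have e : ((n : ℂ) + 1) * (Complex.exp (z / (n + 1)) - 1) - z =
      ((n : ℂ) + 1) * (Complex.exp (z / (n + 1)) - (1 + z / (n + 1))) := by
    field_simp; ring
  rw [e, norm_mul, hn]
  calc _ ≤ ((n : ℝ) + 1) * ((‖z‖ / (n + 1)) ^ 2 * Real.exp (‖z‖ / (n + 1))) := by gcongr
    _ = ‖z‖ ^ 2 * Real.exp (‖z‖ / (n + 1)) * (1 / (n + 1)) := by field_simp
    _ ≤ _ := by gcongr

noncomputable section

/-- `levyQuotient u` as a bounded continuous function. -/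
def levyQuotientBCF (u : ℝ) : ℝ →ᵇ ℂ :=
  BoundedContinuousFunction.ofNormedAddCommGroup (levyQuotient u) (continuous_levyQuotient u) _
    (norm_levyQuotient_le u)

/-- The measure with density `c (1 - sin x / x)` with respect to `μ`. -/
def sincDefectMeasure (c : ℝ) (μ : Measure ℝ) : Measure ℝ :=
  μ.withDensity fun x => ENNReal.ofReal (c * sincDefect x)

end

theorem integral_sincDefectMeasure {c : ℝ} (hc : 0 ≤ c) (μ : Measure ℝ) (f : ℝ → ℂ) :
    ∫ x, f x ∂(sincDefectMeasure c μ) = c * ∫ x, (sincDefect x : ℂ) * f x ∂μ := by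
  rw [sincDefectMeasure, integral_withDensity_eq_integral_toReal_smul (by fun_prop)
    (ae_of_all _ fun _ => ENNReal.ofReal_lt_top), ← integral_const_mul]
  congr with x
  rw [ENNReal.toReal_ofReal (mul_nonneg hc (sincDefect_nonneg x)), Complex.real_smul]
  push_cast
  ring

theorem isFiniteMeasure_sincDefectMeasure {c : ℝ} (hc : 0 ≤ c) (μ : Measure ℝ)
    [IsFiniteMeasure μ] : IsFiniteMeasure (sincDefectMeasure c μ) := by
  refine isFiniteMeasure_withDensity ?_
  have h : ∫⁻ x, ENNReal.ofReal (c * sincDefect x) ∂μ ≤ ∫⁻ _, ENNReal.ofReal (c * 2) ∂μ :=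
    lintegral_mono fun x => ENNReal.ofReal_le_ofReal
      (mul_le_mul_of_nonneg_left (sincDefect_le_two x) hc)
  refine (h.trans_lt ?_).ne
  rw [lintegral_const]
  exact ENNReal.mul_lt_top ENNReal.ofReal_lt_top (measure_lt_top _ _)

theorem integrable_exp_mul_I (μ : Measure ℝ) [IsFiniteMeasure μ] (u : ℝ) :
    Integrable (fun x : ℝ => Complex.exp (u * x * Complex.I)) μ := by
  refine Integrable.of_bound (C := 1) (by fun_prop) (ae_of_all _ fun x => ?_)
  rw [← Complex.ofReal_mul, Complex.norm_exp_ofReal_mul_I]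

/-- Only `c (charFun μ - 1)` enters, the quantity that converges to the exponent; this is why the
weight is `1 - sinc`. -/
theorem charFun_sincDefectMeasure {c : ℝ} (hc : 0 ≤ c) (μ : Measure ℝ) [IsProbabilityMeasure μ]
    (u : ℝ) : charFun (sincDefectMeasure c μ) u =
      c * (charFun μ u - 1) - 2⁻¹ * ∫ h in (-1 : ℝ)..1, c * (charFun μ (u + h) - 1) := by
  rw [charFun_apply_real, integral_sincDefectMeasure hc]
  have hi := integrable_exp_mul_I μ u
  have hi2 : Integrable (fun x : ℝ => (Real.sinc x : ℂ) * Complex.exp (u * x * Complex.I)) μ := by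
    refine hi.bdd_mul (c := 1) ?_ (ae_of_all _ fun x => ?_)
    · exact (Complex.continuous_ofReal.comp Real.continuous_sinc).aestronglyMeasurable
    · simpa using Real.abs_sinc_le_one x
  have h1 : ∫ x, (sincDefect x : ℂ) * Complex.exp (u * x * Complex.I) ∂μ =
      charFun μ u - 2⁻¹ * ∫ h in (-1 : ℝ)..1, charFun μ (u + h) := by
    rw [← integral_sinc_mul_exp, charFun_apply_real, ← integral_sub hi hi2]
    congr with x
    rw [sincDefect]; push_cast; ring
  have hint : IntervalIntegrable (fun h => charFun μ (u + h)) volume (-1) 1 :=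
    Continuous.intervalIntegrable (by fun_prop) _ _
  rw [h1, intervalIntegral.integral_const_mul, intervalIntegral.integral_sub hint
    intervalIntegrable_const]
  simp
  ring

theorem tendsto_charFun_sincDefectMeasure {μ : ℕ → Measure ℝ} [∀ n, IsProbabilityMeasure (μ n)]
    {ψ : ℝ → ℂ} (hψ : Continuous ψ)
    (h : ∀ n u, charFun (μ n) u = Complex.exp (ψ u / (n + 1))) (u : ℝ) :
    Tendsto (fun n : ℕ => charFun (sincDefectMeasure (n + 1) (μ n)) u) atTop
      (𝓝 (ψ u - 2⁻¹ * ∫ v in (-1 : ℝ)..1, ψ (u + v))) := by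
  have hpt (v : ℝ) : Tendsto (fun n : ℕ => (((n : ℝ) + 1 : ℝ) : ℂ) * (charFun (μ n) v - 1)) atTop
      (𝓝 (ψ v)) := by
    refine (tendsto_natCast_mul_exp_sub_one (ψ v)).congr fun n => ?_
    rw [h]; push_cast; rfl
  have hbd (n : ℕ) (v : ℝ) : ‖(((n : ℝ) + 1 : ℝ) : ℂ) * (charFun (μ n) v - 1)‖ ≤
      ‖ψ v‖ * Real.exp ‖ψ v‖ := by
    rw [h]; push_cast
    exact norm_natCast_mul_exp_sub_one_le (ψ v) n
  have hc : Tendsto (fun n : ℕ => ∫ v in (-1 : ℝ)..1,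
      (((n : ℝ) + 1 : ℝ) : ℂ) * (charFun (μ n) (u + v) - 1)) atTop
      (𝓝 (∫ v in (-1 : ℝ)..1, ψ (u + v))) := by
    refine intervalIntegral.tendsto_integral_filter_of_dominated_convergence
      (fun v => ‖ψ (u + v)‖ * Real.exp ‖ψ (u + v)‖) ?_ ?_ ?_ ?_
    · exact Eventually.of_forall fun n => Continuous.aestronglyMeasurable (by fun_prop)
    · exact Eventually.of_forall fun n => ae_of_all _ fun v _ => hbd n (u + v)
    · exact Continuous.intervalIntegrable (by fun_prop) _ _
    · exact ae_of_all _ fun v _ => hpt (u + v)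
  refine ((hpt u).sub (hc.const_mul 2⁻¹)).congr fun n => ?_
  rw [charFun_sincDefectMeasure (by positivity)]

/-- A form of the Lévy–Khintchine formula with a single finite measure. -/
theorem exists_exponent_eq_integral_levyQuotient {μ : ℕ → Measure ℝ}
    [∀ n, IsProbabilityMeasure (μ n)] {ψ : ℝ → ℂ} (hψ : Continuous ψ)
    (h : ∀ n u, charFun (μ n) u = Complex.exp (ψ u / (n + 1))) :
    ∃ (b : ℝ) (G : Measure ℝ), IsFiniteMeasure G ∧
      ∀ u, ψ u = Complex.I * u * b + ∫ x, levyQuotient u x ∂G := by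
  have hfin (n : ℕ) : IsFiniteMeasure (sincDefectMeasure (n + 1) (μ n)) :=
    isFiniteMeasure_sincDefectMeasure (by positivity) _
  have hcont : Continuous fun u : ℝ => ψ u - 2⁻¹ * ∫ v in (-1 : ℝ)..1, ψ (u + v) := by
    have : Continuous fun u : ℝ => ∫ v in (-1 : ℝ)..1, ψ (u + v) :=
      intervalIntegral.continuous_parametric_intervalIntegral_of_continuous' (by fun_prop) _ _
    fun_prop
  obtain ⟨U, G, hU, hG, hlim⟩ := exists_ultrafilter_tendsto_integral
    hcont.continuousAt (tendsto_charFun_sincDefectMeasure hψ h)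
  -- The truncated drift. Nothing bounds it in advance: it converges along `U` because the other two
  -- terms of the decomposition below do.
  set b : ℕ → ℝ := fun n => (n + 1) * ∫ x, clampUnit x ∂(μ n) with hb
  have hdecomp (n : ℕ) (u : ℝ) : ((n : ℂ) + 1) * (charFun (μ n) u - 1) =
      ∫ x, levyQuotient u x ∂(sincDefectMeasure (n + 1) (μ n)) + Complex.I * u * b n := by
    have hi := integrable_exp_mul_I (μ n) u
    have hτ : Integrable (fun x => Complex.I * u * (clampUnit x : ℝ)) (μ n) := by
      refine Integrable.const_mul (Integrable.ofReal ?_) _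
      exact Integrable.of_bound (C := 1) continuous_clampUnit.aestronglyMeasurable
        (ae_of_all _ abs_clampUnit_le)
    have e : charFun (μ n) u - 1 = ∫ x, levyIntegrand u x ∂(μ n) +
        Complex.I * u * (∫ x, clampUnit x ∂(μ n) : ℝ) := by
      have h1 : ∫ x, levyIntegrand u x ∂(μ n) =
          ∫ x, (Complex.exp (u * x * Complex.I) - 1 -
            Complex.I * u * (clampUnit x : ℝ)) ∂(μ n) := by
        congr with x
        rw [levyIntegrand]; ring_nf
      have h2 : Integrable (fun x : ℝ => Complex.exp (u * x * Complex.I) - 1) (μ n) :=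
        hi.sub (integrable_const _)
      rw [h1, integral_sub h2 hτ, integral_sub hi (integrable_const _),
        integral_const_mul, integral_complex_ofReal, charFun_apply_real]
      simp
    rw [integral_sincDefectMeasure (by positivity), e]
    simp only [sincDefect_mul_levyQuotient, hb]
    push_cast
    ring
  have hbU (u : ℝ) : Tendsto (fun n => Complex.I * u * (b n : ℂ)) U
      (𝓝 (ψ u - ∫ x, levyQuotient u x ∂G)) := by
    have h1 : Tendsto (fun n : ℕ => ((n : ℂ) + 1) * (charFun (μ n) u - 1)) atTop (𝓝 (ψ u)) :=
      (tendsto_natCast_mul_exp_sub_one (ψ u)).congr fun n => by rw [h]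
    refine ((h1.mono_left hU).sub (hlim (levyQuotientBCF u))).congr fun n => ?_
    rw [hdecomp]
    exact add_sub_cancel_left _ _
  -- At `u = 1` the drift is the imaginary part of a convergent family.
  obtain ⟨b', hb'⟩ : ∃ b' : ℝ, Tendsto b U (𝓝 b') := by
    refine ⟨_, ((Complex.continuous_im.tendsto _).comp (hbU 1)).congr fun n => ?_⟩
    simp
  refine ⟨b', G, hG, fun u => ?_⟩
  have h1 : Tendsto (fun n => Complex.I * u * (b n : ℂ)) U (𝓝 (Complex.I * u * b')) :=
    ((Complex.continuous_ofReal.tendsto _).comp hb').const_mul _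
  have h2 := tendsto_nhds_unique h1 (hbU u)
  rw [h2]; ring

/-- The density cancels `sincDefect` in `min 1 x² ≤ 40 * sincDefect x`, leaving at most `40` times
the mass of `G`. -/
theorem lintegral_min_lt_top_of_density (G : Measure ℝ) [IsFiniteMeasure G] :
    ∫⁻ x, ENNReal.ofReal (min 1 (x ^ 2))
      ∂((G.restrict {0}ᶜ).withDensity fun x => ENNReal.ofReal (sincDefect x)⁻¹) < ⊤ := by
  rw [lintegral_withDensity_eq_lintegral_mul _ (by fun_prop) (by fun_prop)]
  refine lt_of_le_of_lt (lintegral_mono (g := fun _ => ENNReal.ofReal 40) fun x => ?_) ?_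
  · simp only [Pi.mul_apply]
    rw [← ENNReal.ofReal_mul (inv_nonneg.2 (sincDefect_nonneg x))]
    refine ENNReal.ofReal_le_ofReal ?_
    rcases eq_or_ne x 0 with rfl | hx
    · simp
    · rw [inv_mul_le_iff₀ (sincDefect_pos hx), mul_comm]
      exact min_le_sincDefect x
  · rw [lintegral_const]
    exact ENNReal.mul_lt_top ENNReal.ofReal_lt_top (measure_lt_top _ _)

theorem IsLevyMeasure.integrable_min {ν : Measure ℝ} (hν : IsLevyMeasure ν) :
    Integrable (fun x : ℝ => min 1 (x ^ 2)) ν := by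
  refine ⟨by fun_prop, ?_⟩
  rw [hasFiniteIntegral_iff_ofReal (ae_of_all _ fun x => le_min zero_le_one (sq_nonneg x))]
  exact hν.lintegral_lt_top

theorem IsLevyMeasure.integrable_levyIntegrand {ν : Measure ℝ} (hν : IsLevyMeasure ν) (u : ℝ) :
    Integrable (levyIntegrand u) ν :=
  (hν.integrable_min.const_mul _).mono' (continuous_levyIntegrand u).aestronglyMeasurable
    (ae_of_all _ (norm_levyIntegrand_le u))

theorem measurable_indicator_abs_le :
    Measurable ({y : ℝ | |y| ≤ 1}.indicator fun y => y) :=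
  measurable_id.indicator (measurableSet_le (by fun_prop) measurable_const)

theorem IsLevyMeasure.integrable_clampUnit_sub {ν : Measure ℝ} (hν : IsLevyMeasure ν) :
    Integrable (fun x => clampUnit x - {y : ℝ | |y| ≤ 1}.indicator (fun y => y) x) ν := by
  refine hν.integrable_min.mono'
    (continuous_clampUnit.measurable.sub measurable_indicator_abs_le).aestronglyMeasurable
    (ae_of_all _ fun x => ?_)
  by_cases hx : |x| ≤ 1
  · rw [Set.indicator_of_mem (by exact hx), clampUnit_of_abs_le hx, sub_self, norm_zero]
    positivity
  · rw [Set.indicator_of_notMem (by exact hx), sub_zero, min_eq_left]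
    · exact abs_clampUnit_le x
    · rw [← sq_abs]; exact one_le_pow₀ (not_le.1 hx).le

/-- **Lévy–Khintchine formula**, existence part. -/
theorem exists_levyKhintchine {μ : ℕ → Measure ℝ} [∀ n, IsProbabilityMeasure (μ n)] {ψ : ℝ → ℂ}
    (hψ : Continuous ψ) (h : ∀ n u, charFun (μ n) u = Complex.exp (ψ u / (n + 1))) :
    ∃ (m s : ℝ) (ν : Measure ℝ), IsLevyMeasure ν ∧ ∀ u : ℝ, ψ u =
      Complex.I * u * m - (s ^ 2 : ℝ) * u ^ 2 / 2 +
        ∫ x : ℝ, (Complex.exp (Complex.I * u * x) - 1 -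
          Complex.I * u * ({y : ℝ | |y| ≤ 1}.indicator (fun y => y) x : ℝ)) ∂ν := by
  obtain ⟨b, G, hG, hGψ⟩ := exists_exponent_eq_integral_levyQuotient hψ h
  set ν := (G.restrict {0}ᶜ).withDensity fun x => ENNReal.ofReal (sincDefect x)⁻¹ with hνdef
  have hν : IsLevyMeasure ν := by
    refine ⟨withDensity_absolutelyContinuous _ _ ?_, lintegral_min_lt_top_of_density G⟩
    rw [Measure.restrict_apply (measurableSet_singleton 0)]
    simp
  -- The drift pays for replacing the continuous truncation by the sharp one. The variance is `6
  -- G{0}` because the atom contributes `-3u² G{0} = -s²u²/2`.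
  refine ⟨b - ∫ x, (clampUnit x - {y : ℝ | |y| ≤ 1}.indicator (fun y => y) x) ∂ν,
    √(6 * G.real {0}), ν, hν, fun u => ?_⟩
  have hsq : (√(6 * G.real {0})) ^ 2 = 6 * G.real {0} :=
    Real.sq_sqrt (mul_nonneg (by norm_num) measureReal_nonneg)
  have hsplit : ∫ x, levyQuotient u x ∂G =
      G.real {0} * (-3 * (u : ℂ) ^ 2) + ∫ x, levyIntegrand u x ∂ν := by
    have hi : Integrable (levyQuotient u) G := (levyQuotientBCF u).integrable G
    rw [← integral_add_compl (measurableSet_singleton (0 : ℝ)) hi]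
    congr 1
    · rw [integral_singleton, levyQuotient, Function.update_self, Complex.real_smul]
    · rw [hνdef, integral_withDensity_eq_integral_toReal_smul (by fun_prop)
        (ae_of_all _ fun _ => ENNReal.ofReal_lt_top)]
      refine setIntegral_congr_fun (measurableSet_singleton (0 : ℝ)).compl fun x hx => ?_
      rw [levyQuotient, Function.update_of_ne hx, ENNReal.toReal_ofReal
        (inv_nonneg.2 (sincDefect_nonneg x)), Complex.real_smul]
      push_cast
      rw [div_eq_inv_mul]
  have hshift : ∫ x : ℝ, (Complex.exp (Complex.I * u * x) - 1 -
        Complex.I * u * ({y : ℝ | |y| ≤ 1}.indicator (fun y => y) x : ℝ)) ∂ν =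
      ∫ x, levyIntegrand u x ∂ν + Complex.I * u *
        (∫ x, (clampUnit x - {y : ℝ | |y| ≤ 1}.indicator (fun y => y) x) ∂ν : ℝ) := by
    have hi : Integrable (fun x => Complex.I * u *
        ((clampUnit x - {y : ℝ | |y| ≤ 1}.indicator (fun y => y) x : ℝ) : ℂ)) ν :=
      hν.integrable_clampUnit_sub.ofReal.const_mul _
    rw [← integral_complex_ofReal, ← integral_const_mul,
      ← integral_add (hν.integrable_levyIntegrand u) hi]
    congr with x
    rw [levyIntegrand]; push_cast; ring
  rw [hGψ, hsplit, hshift, hsq]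
  push_cast
  ring

theorem IsLevyProcess.exists_levyTriplet {Ω : Type*} [MeasurableSpace Ω] {P : Measure Ω}
    [IsProbabilityMeasure P] {X : ℝ≥0 → Ω → ℝ} (hX : IsLevyProcess X P) :
    ∃ (m s : ℝ) (ν : Measure ℝ), IsLevyTriplet X P m (s ^ 2) ν := by
  obtain ⟨ψ, hψ, -, hexp⟩ := hX.exists_exponent
  have hp (t : ℝ≥0) : IsProbabilityMeasure (P.map (X t)) :=
    Measure.isProbabilityMeasure_map (hX.measurable t).aemeasurable
  -- The law at time `1/(n+1)` is the `(n+1)`-th convolution root of the law of `X 1`.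
  obtain ⟨m, s, ν, hν, hf⟩ := exists_levyKhintchine
    (μ := fun n : ℕ => P.map (X ((n + 1 : ℝ≥0)⁻¹))) hψ (fun n u => by
      rw [hexp]; push_cast; congr 1; rw [div_eq_inv_mul])
  refine ⟨m, s, ν, sq_nonneg s, hν, fun u => ?_⟩
  rw [hexp, ← hf]
  simp

/-! ### From smooth characteristic functions to moments. -/

theorem re_charFun_eq_integral_cos (ρ : Measure ℝ) [IsFiniteMeasure ρ] (h : ℝ) :
    (charFun ρ h).re = ∫ x, Real.cos (h * x) ∂ρ := by
  have := integral_re (integrable_exp_mul_I ρ h)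
  rw [charFun_apply_real]
  refine Eq.trans this.symm ?_
  congr with x
  rw [← Complex.ofReal_mul]
  exact Complex.exp_ofReal_mul_I_re _

/-- The real part is even, so its derivative vanishes at `0` and is `O(h)` there; the mean value
inequality makes the defect quadratic. -/
theorem exists_sub_re_charFun_le {ρ : Measure ℝ} [IsFiniteMeasure ρ]
    (hf : ContDiff ℝ 2 (charFun ρ)) :
    ∃ C : ℝ, ∀ᶠ h in 𝓝[>] (0 : ℝ), ρ.real Set.univ - (charFun ρ h).re ≤ C * h ^ 2 := by
  set r : ℝ → ℝ := fun h => (charFun ρ h).re with hr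
  have hrc : ContDiff ℝ 2 r := Complex.reCLM.contDiff.comp hf
  have hr0 : r 0 = ρ.real Set.univ := by simp [hr]
  have hd0 : deriv r 0 = 0 := by
    have heven : (fun h => r (-h)) = r := by
      ext h; simp [hr, charFun_neg]
    have h1 := deriv_comp_neg r 0
    rw [heven, neg_zero] at h1
    linarith
  have hO := ((hrc.differentiable_deriv_two 0).hasDerivAt).isBigO_sub
  obtain ⟨C, hC⟩ := hO.bound
  obtain ⟨δ, hδ, hball⟩ := Metric.eventually_nhds_iff.1 hC
  have hCle : ∀ x, |x| < δ → |deriv r x| ≤ C * |x| := fun x hx => by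
    simpa [hd0] using hball (by simpa using hx : dist x 0 < δ)
  refine ⟨C, ?_⟩
  filter_upwards [Ioo_mem_nhdsGT hδ] with h hh
  have hC0 : 0 ≤ C := by
    have h1 := hCle h (by rw [abs_of_pos hh.1]; exact hh.2)
    by_contra! hneg
    have := mul_neg_of_neg_of_pos hneg (abs_pos.2 hh.1.ne')
    linarith [abs_nonneg (deriv r h)]
  have hmv := Convex.norm_image_sub_le_of_norm_hasDerivWithin_le (f := r) (f' := deriv r)
    (s := Set.Icc 0 h) (C := C * h) (x := 0) (y := h)
    (fun x _ => ((hrc.differentiable (by norm_num)) x).hasDerivAt.hasDerivWithinAt)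
    (fun x hx => by
      refine (hCle x ?_).trans ?_
      · rw [abs_of_nonneg hx.1]; exact hx.2.trans_lt hh.2
      · rw [abs_of_nonneg hx.1]; exact mul_le_mul_of_nonneg_left hx.2 hC0)
    (convex_Icc 0 h) ⟨le_rfl, hh.1.le⟩ ⟨hh.1.le, le_rfl⟩
  rw [hr0, sub_zero, Real.norm_eq_abs, Real.norm_eq_abs, abs_of_pos hh.1] at hmv
  have := (abs_le.1 hmv).1
  change ρ.real Set.univ - r h ≤ _
  nlinarith

theorem sq_le_one_sub_cos {y : ℝ} (hy : |y| ≤ 1) : y ^ 2 ≤ 4 * (1 - Real.cos y) := by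
  have h := (abs_le.1 (Real.cos_bound hy)).2
  have h2 : |y| ^ 4 ≤ y ^ 2 := by
    rw [← sq_abs y]
    exact pow_le_pow_of_le_one (abs_nonneg y) hy (by norm_num)
  nlinarith [sq_nonneg y]

/-- A finite measure with twice continuously differentiable characteristic function has a finite
second moment. -/
theorem integrable_sq_of_contDiff_charFun {ρ : Measure ℝ} [IsFiniteMeasure ρ]
    (hf : ContDiff ℝ 2 (charFun ρ)) : Integrable (fun x : ℝ => x ^ 2) ρ := by
  obtain ⟨C, hC⟩ := exists_sub_re_charFun_le hf
  have hcover : AECover ρ atTop fun n : ℕ => Set.Icc (-(n : ℝ)) n :=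
    aecover_Icc (tendsto_neg_atTop_atBot.comp tendsto_natCast_atTop_atTop)
      tendsto_natCast_atTop_atTop
  refine hcover.integrable_of_integral_norm_bounded (4 * C) (fun n => ?_) ?_
  · exact (by fun_prop : Continuous fun x : ℝ => x ^ 2).continuousOn.integrableOn_compact
      isCompact_Icc
  -- With `h = 1/n`, the function `4n²(1 - cos (x/n))` dominates `x²` on `[-n, n]`, and its integral
  -- is at most `4C`.
  have hinv : Tendsto (fun n : ℕ => ((n : ℝ))⁻¹) atTop (𝓝[>] 0) :=
    tendsto_inv_atTop_nhdsGT_zero.comp tendsto_natCast_atTop_atTop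
  filter_upwards [hinv.eventually hC, eventually_gt_atTop 0] with n hn hn0
  have hnpos : (0 : ℝ) < n := Nat.cast_pos.2 hn0
  have hcos : Integrable (fun x : ℝ => Real.cos ((n : ℝ)⁻¹ * x)) ρ :=
    Integrable.of_bound (C := 1) (by fun_prop) (ae_of_all _ fun x => Real.abs_cos_le_one _)
  have hint : Integrable (fun x : ℝ => 4 * (n : ℝ) ^ 2 * (1 - Real.cos ((n : ℝ)⁻¹ * x))) ρ :=
    ((integrable_const 1).sub hcos).const_mul _
  calc ∫ x in Set.Icc (-(n : ℝ)) n, ‖x ^ 2‖ ∂ρ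
      ≤ ∫ x in Set.Icc (-(n : ℝ)) n, 4 * (n : ℝ) ^ 2 * (1 - Real.cos ((n : ℝ)⁻¹ * x)) ∂ρ := by
        refine setIntegral_mono_on ?_ hint.integrableOn measurableSet_Icc fun x hx => ?_
        · exact (by fun_prop : Continuous fun x : ℝ => ‖x ^ 2‖).continuousOn.integrableOn_compact
            isCompact_Icc
        · have h1 : |(n : ℝ)⁻¹ * x| ≤ 1 := by
            rw [abs_mul, abs_inv, abs_of_pos hnpos, inv_mul_le_iff₀ hnpos, mul_one]
            exact abs_le.2 hx
          have h2 := mul_le_mul_of_nonneg_left (sq_le_one_sub_cos h1) (sq_nonneg (n : ℝ))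
          have h3 : (n : ℝ) ^ 2 * ((n : ℝ)⁻¹ * x) ^ 2 = x ^ 2 := by field_simp
          rw [Real.norm_of_nonneg (sq_nonneg x)]
          linarith
    _ ≤ ∫ x, 4 * (n : ℝ) ^ 2 * (1 - Real.cos ((n : ℝ)⁻¹ * x)) ∂ρ :=
        setIntegral_le_integral hint (ae_of_all _ fun x =>
          mul_nonneg (by positivity) (sub_nonneg.2 (Real.cos_le_one _)))
    _ = 4 * (n : ℝ) ^ 2 * (ρ.real Set.univ - (charFun ρ (n : ℝ)⁻¹).re) := by
        rw [integral_const_mul, integral_sub (integrable_const _) hcos,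
          re_charFun_eq_integral_cos]
        simp
    _ ≤ 4 * (n : ℝ) ^ 2 * (C * ((n : ℝ)⁻¹) ^ 2) := by gcongr
    _ = 4 * C := by field_simp

theorem memLp_id_of_integrable_pow {ρ : Measure ℝ} [IsFiniteMeasure ρ] {k : ℕ}
    (h : Integrable (fun x : ℝ => x ^ (2 * k)) ρ) : MemLp id ((2 * k : ℕ) : ℝ≥0∞) ρ := by
  rcases eq_or_ne k 0 with rfl | hk
  · simpa using aestronglyMeasurable_id
  · rw [← integrable_norm_rpow_iff aestronglyMeasurable_id
      (by simpa using hk) (ENNReal.natCast_ne_top _)]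
    refine h.congr (ae_of_all _ fun x => ?_)
    simp only [ENNReal.toReal_natCast, Real.rpow_natCast, id, Real.norm_eq_abs]
    rw [Even.pow_abs (even_two_mul k)]

/-- The measure with density `x ^ (2 k)` with respect to `ρ`. -/
noncomputable def evenMomentMeasure (k : ℕ) (ρ : Measure ℝ) : Measure ℝ :=
  ρ.withDensity fun x => ENNReal.ofReal (x ^ (2 * k))

theorem integral_evenMomentMeasure {E : Type*} [NormedAddCommGroup E] [NormedSpace ℝ E] (k : ℕ)
    (ρ : Measure ℝ) (f : ℝ → E) :
    ∫ x, f x ∂(evenMomentMeasure k ρ) = ∫ x, x ^ (2 * k) • f x ∂ρ := by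
  rw [evenMomentMeasure, integral_withDensity_eq_integral_toReal_smul (by fun_prop)
    (ae_of_all _ fun _ => ENNReal.ofReal_lt_top)]
  congr with x
  rw [ENNReal.toReal_ofReal ((even_two_mul k).pow_nonneg x)]

theorem integrable_evenMomentMeasure_iff {E : Type*} [NormedAddCommGroup E] [NormedSpace ℝ E]
    (k : ℕ) (ρ : Measure ℝ) (f : ℝ → E) :
    Integrable f (evenMomentMeasure k ρ) ↔ Integrable (fun x => x ^ (2 * k) • f x) ρ := by
  rw [evenMomentMeasure, integrable_withDensity_iff_integrable_smul' (by fun_prop)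
    (ae_of_all _ fun _ => ENNReal.ofReal_lt_top)]
  simp only [ENNReal.toReal_ofReal ((even_two_mul k).pow_nonneg _)]

theorem isFiniteMeasure_evenMomentMeasure {k : ℕ} {ρ : Measure ℝ}
    (h : Integrable (fun x : ℝ => x ^ (2 * k)) ρ) : IsFiniteMeasure (evenMomentMeasure k ρ) := by
  refine isFiniteMeasure_withDensity ?_
  have := h.2
  rw [hasFiniteIntegral_iff_ofReal (ae_of_all _ fun x => (even_two_mul k).pow_nonneg x)] at this
  exact this.ne

/-- Differentiating `2k` times brings down `(ix)^(2k) = (-1)^k x^(2k)`; smoothness thus passes to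
the weighted measure. -/
theorem charFun_evenMomentMeasure {k : ℕ} {ρ : Measure ℝ} [IsFiniteMeasure ρ]
    (h : Integrable (fun x : ℝ => x ^ (2 * k)) ρ) :
    charFun (evenMomentMeasure k ρ) = fun u => (-1) ^ k * iteratedDeriv (2 * k) (charFun ρ) u := by
  ext u
  rw [iteratedDeriv_charFun (memLp_id_of_integrable_pow h), pow_mul, Complex.I_sq, ← mul_assoc,
    ← mul_pow, charFun_apply_real, integral_evenMomentMeasure]
  norm_num

/-- A finite measure with smooth characteristic function has moments of all orders. -/
theorem memLp_id_of_contDiff_charFun {ρ : Measure ℝ} [IsFiniteMeasure ρ]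
    (hf : ContDiff ℝ ∞ (charFun ρ)) (n : ℕ) : MemLp id n ρ := by
  -- Each step gains two moments, by applying the second moment criterion to the measure weighted by
  -- `x^(2k)`.
  have key (k : ℕ) : Integrable (fun x : ℝ => x ^ (2 * k)) ρ := by
    induction k with
    | zero => simp
    | succ k ih =>
      have := isFiniteMeasure_evenMomentMeasure ih
      have hc : ContDiff ℝ 2 (charFun (evenMomentMeasure k ρ)) := by
        rw [charFun_evenMomentMeasure ih]
        refine contDiff_const.mul ?_
        rw [iteratedDeriv_eq_iterate]
        exact ContDiff.iterate_deriv' 2 (2 * k) (contDiff_infty.1 hf _)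
      have h2 := (integrable_evenMomentMeasure_iff k ρ _).1 (integrable_sq_of_contDiff_charFun hc)
      refine h2.congr (ae_of_all _ fun x => ?_)
      simp only [smul_eq_mul]
      ring
  exact (memLp_id_of_integrable_pow (key n)).mono_exponent
    (by exact_mod_cast Nat.le_mul_of_pos_left n two_pos)

/-! ### Derivatives of the Lévy–Khintchine exponent. -/

theorem norm_exp_I_mul_sub_one_sub_le (y : ℝ) :
    ‖Complex.exp (Complex.I * y) - 1 - Complex.I * y‖ ≤ 3 * y ^ 2 := by
  have hn : ‖Complex.I * (y : ℂ)‖ = |y| := by simp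
  rcases le_or_gt |y| 1 with hy | hy
  · have h := Complex.norm_exp_sub_one_sub_id_le (x := Complex.I * y) (by rwa [hn])
    rw [hn, sq_abs] at h
    linarith [sq_nonneg y]
  · have h1 := norm_sub_le (Complex.exp (Complex.I * y) - 1) (Complex.I * y)
    have h2 := norm_sub_le (Complex.exp (Complex.I * y)) 1
    rw [norm_one, Complex.norm_exp_I_mul_ofReal] at h2
    have h3 : |y| ≤ y ^ 2 := by rw [← sq_abs]; nlinarith
    rw [hn] at h1
    linarith

section Exponent

variable {ν : Measure ℝ}

theorem integrable_exp_sub_one_sub (h2 : Integrable (fun x : ℝ => x ^ 2) ν) (u : ℝ) :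
    Integrable (fun x : ℝ => Complex.exp (Complex.I * u * x) - 1 - Complex.I * u * x) ν := by
  refine (h2.const_mul (3 * u ^ 2)).mono' (by fun_prop) (ae_of_all _ fun x => ?_)
  have h := norm_exp_I_mul_sub_one_sub_le (u * x)
  push_cast at h
  rw [← mul_assoc] at h
  refine h.trans (le_of_eq (by ring))

theorem norm_mul_exp_sub_one_le (u x : ℝ) :
    ‖Complex.I * x * (Complex.exp (Complex.I * u * x) - 1)‖ ≤ |u| * x ^ 2 := by
  have h := Real.norm_exp_I_mul_ofReal_sub_one_le (x := u * x)
  push_cast at h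
  rw [← mul_assoc, Real.norm_eq_abs, abs_mul] at h
  have hx : ‖Complex.I * (x : ℂ)‖ = |x| := by simp
  rw [norm_mul, hx]
  calc _ ≤ |x| * (|u| * |x|) := by gcongr
    _ = |u| * |x| ^ 2 := by ring
    _ = _ := by rw [sq_abs]

theorem hasDerivAt_exp_I_mul (u x : ℝ) :
    HasDerivAt (fun u : ℝ => Complex.exp (Complex.I * u * x))
      (Complex.exp (Complex.I * u * x) * (Complex.I * 1 * x)) u :=
  ((((Complex.ofRealCLM.hasDerivAt).const_mul Complex.I).mul_const (x : ℂ))).cexp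

theorem hasDerivAt_integral_exp_sub_one_sub (h2 : Integrable (fun x : ℝ => x ^ 2) ν) (u : ℝ) :
    HasDerivAt (fun u : ℝ =>
        ∫ x : ℝ, (Complex.exp (Complex.I * u * x) - 1 - Complex.I * u * x) ∂ν)
      (∫ x : ℝ, Complex.I * x * (Complex.exp (Complex.I * u * x) - 1) ∂ν) u := by
  refine (hasDerivAt_integral_of_dominated_loc_of_deriv_le
    (F := fun (u : ℝ) (x : ℝ) => Complex.exp (Complex.I * u * x) - 1 - Complex.I * u * x)
    (F' := fun (u : ℝ) (x : ℝ) => Complex.I * x * (Complex.exp (Complex.I * u * x) - 1))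
    (bound := fun x => (|u| + 1) * x ^ 2) (Metric.ball_mem_nhds u one_pos)
    (Eventually.of_forall fun v => by fun_prop) (integrable_exp_sub_one_sub h2 u) (by fun_prop)
    (ae_of_all _ fun x v hv => ?_) (h2.const_mul _) (ae_of_all _ fun x v _ => ?_)).2
  · refine (norm_mul_exp_sub_one_le v x).trans ?_
    have : |v| ≤ |u| + 1 := by
      have h1 : |v - u| < 1 := by simpa [Real.dist_eq] using hv
      have h3 := abs_sub_abs_le_abs_sub v u
      linarith
    gcongr
  · have h1 : HasDerivAt (fun v : ℝ => Complex.I * (v : ℂ) * x) (Complex.I * 1 * x) v :=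
      ((Complex.ofRealCLM.hasDerivAt).const_mul Complex.I).mul_const (x : ℂ)
    refine (((hasDerivAt_exp_I_mul v x).sub_const 1).sub h1).congr_deriv ?_
    ring

/-- Although `ν` may be infinite, `x² dν` is finite, so all further derivatives come from the theory
of characteristic functions. -/
theorem hasDerivAt_integral_mul_exp_sub_one (h2 : Integrable (fun x : ℝ => x ^ 2) ν) (u : ℝ) :
    HasDerivAt (fun u : ℝ => ∫ x : ℝ, Complex.I * x * (Complex.exp (Complex.I * u * x) - 1) ∂ν)
      (-charFun (evenMomentMeasure 1 ν) u) u := by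
  have h := (hasDerivAt_integral_of_dominated_loc_of_deriv_le
    (F := fun (u : ℝ) (x : ℝ) => Complex.I * x * (Complex.exp (Complex.I * u * x) - 1))
    (F' := fun (u : ℝ) (x : ℝ) =>
      Complex.I * x * (Complex.exp (Complex.I * u * x) * (Complex.I * 1 * x)))
    (μ := ν) (bound := fun x => x ^ 2) (Metric.ball_mem_nhds u one_pos)
    (Eventually.of_forall fun v => by fun_prop)
    ((h2.const_mul |u|).mono' (by fun_prop) (ae_of_all _ (norm_mul_exp_sub_one_le u)))
    (by fun_prop)
    (ae_of_all _ fun x v _ => ?_) h2 (ae_of_all _ fun x v _ => ?_)).2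
  · refine h.congr_deriv ?_
    rw [charFun_apply_real, integral_evenMomentMeasure, ← integral_neg]
    congr with x
    rw [Complex.real_smul]
    have e : Complex.I * u * x = u * x * Complex.I := by ring
    rw [e]
    push_cast
    linear_combination (x : ℂ) ^ 2 * Complex.exp (u * x * Complex.I) * Complex.I_mul_I
  · have e : Complex.I * (v : ℂ) * x = Complex.I * ((v * x : ℝ) : ℂ) := by push_cast; ring
    rw [e]
    simp only [norm_mul, Complex.norm_I, Complex.norm_real, Complex.norm_exp_I_mul_ofReal, one_mul,
      Real.norm_eq_abs, mul_one, abs_mul_abs_self]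
    exact (sq x).ge
  · exact ((hasDerivAt_exp_I_mul v x).sub_const 1).const_mul _

/-- The Lévy–Khintchine exponent with full compensation of the jumps. -/
noncomputable def levyExponent (c s : ℝ) (ν : Measure ℝ) (u : ℝ) : ℂ :=
  Complex.I * u * c - (s ^ 2 : ℝ) * u ^ 2 / 2 +
    ∫ x : ℝ, (Complex.exp (Complex.I * u * x) - 1 - Complex.I * u * x) ∂ν

/-- The derivative of `levyExponent`. -/
noncomputable def levyExponentDeriv (c s : ℝ) (ν : Measure ℝ) (u : ℝ) : ℂ :=
  Complex.I * c - (s ^ 2 : ℝ) * u +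
    ∫ x : ℝ, Complex.I * x * (Complex.exp (Complex.I * u * x) - 1) ∂ν

theorem hasDerivAt_levyExponent (c s : ℝ) (h2 : Integrable (fun x : ℝ => x ^ 2) ν) (u : ℝ) :
    HasDerivAt (levyExponent c s ν) (levyExponentDeriv c s ν u) u := by
  have hid : HasDerivAt (fun v : ℝ => (v : ℂ)) 1 u := Complex.ofRealCLM.hasDerivAt
  have h := ((((hid.const_mul Complex.I).mul_const (c : ℂ)).sub
    (((hid.pow 2).const_mul (((s ^ 2 : ℝ) : ℂ))).div_const 2)).add
    (hasDerivAt_integral_exp_sub_one_sub h2 u))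
  refine h.congr_deriv ?_
  simp only [levyExponentDeriv]
  push_cast
  ring

theorem hasDerivAt_levyExponentDeriv (c s : ℝ) (h2 : Integrable (fun x : ℝ => x ^ 2) ν) (u : ℝ) :
    HasDerivAt (levyExponentDeriv c s ν)
      (-((s ^ 2 : ℝ) : ℂ) - charFun (evenMomentMeasure 1 ν) u) u := by
  have hid : HasDerivAt (fun v : ℝ => (v : ℂ)) 1 u := Complex.ofRealCLM.hasDerivAt
  have h := ((hid.const_mul (((s ^ 2 : ℝ) : ℂ))).const_sub (Complex.I * c)).add
    (hasDerivAt_integral_mul_exp_sub_one h2 u)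
  refine h.congr_deriv ?_
  ring

theorem memLp_id_evenMomentMeasure_one
    (hmom : ∀ n : ℕ, 2 ≤ n → Integrable (fun x : ℝ => x ^ n) ν) (n : ℕ) :
    MemLp id n (evenMomentMeasure 1 ν) := by
  have := isFiniteMeasure_evenMomentMeasure (k := 1) (hmom 2 le_rfl)
  refine (memLp_id_of_integrable_pow (k := n) ?_).mono_exponent
    (by exact_mod_cast Nat.le_mul_of_pos_left n two_pos)
  rw [integrable_evenMomentMeasure_iff]
  refine (hmom (2 + 2 * n) (by omega)).congr (ae_of_all _ fun x => ?_)
  simp only [smul_eq_mul]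
  ring

theorem contDiff_levyExponentDeriv
    (hmom : ∀ n : ℕ, 2 ≤ n → Integrable (fun x : ℝ => x ^ n) ν) (c s : ℝ) :
    ContDiff ℝ ∞ (levyExponentDeriv c s ν) := by
  have := isFiniteMeasure_evenMomentMeasure (k := 1) (hmom 2 le_rfl)
  refine contDiff_infty_iff_deriv.2
    ⟨fun u => (hasDerivAt_levyExponentDeriv c s (hmom 2 le_rfl) u).differentiableAt, ?_⟩
  rw [funext fun u => (hasDerivAt_levyExponentDeriv c s (hmom 2 le_rfl) u).deriv]
  exact contDiff_const.sub (contDiff_charFun' (memLp_id_evenMomentMeasure_one hmom))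

theorem contDiff_levyExponent
    (hmom : ∀ n : ℕ, 2 ≤ n → Integrable (fun x : ℝ => x ^ n) ν) (c s : ℝ) :
    ContDiff ℝ ∞ (levyExponent c s ν) := by
  refine contDiff_infty_iff_deriv.2
    ⟨fun u => (hasDerivAt_levyExponent c s (hmom 2 le_rfl) u).differentiableAt, ?_⟩
  rw [funext fun u => (hasDerivAt_levyExponent c s (hmom 2 le_rfl) u).deriv]
  exact contDiff_levyExponentDeriv hmom c s

theorem iteratedDeriv_succ_levyExponentDeriv
    (hmom : ∀ n : ℕ, 2 ≤ n → Integrable (fun x : ℝ => x ^ n) ν) (c s : ℝ) (n : ℕ) :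
    iteratedDeriv (n + 1) (levyExponentDeriv c s ν) 0 =
      Complex.I ^ (n + 2) * ((if n = 0 then s ^ 2 else 0) + ∫ x, x ^ (n + 2) ∂ν : ℝ) := by
  have := isFiniteMeasure_evenMomentMeasure (k := 1) (hmom 2 le_rfl)
  have hρ : ∫ x, x ^ n ∂(evenMomentMeasure 1 ν) = ∫ x, x ^ (n + 2) ∂ν := by
    rw [integral_evenMomentMeasure]
    congr with x
    simp only [smul_eq_mul]
    ring
  have hcf := iteratedDeriv_charFun_zero (memLp_id_evenMomentMeasure_one hmom n)
  rw [hρ] at hcf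
  rw [iteratedDeriv_succ', funext fun u =>
    (hasDerivAt_levyExponentDeriv c s (hmom 2 le_rfl) u).deriv]
  -- The Gaussian constant `-s²` survives only when the second derivative is not differentiated
  -- further.
  rcases Nat.eq_zero_or_pos n with rfl | hn
  · simp only [iteratedDeriv_zero] at hcf ⊢
    rw [hcf]
    simp
    ring
  · rw [iteratedDeriv_const_sub hn, iteratedDeriv_neg, hcf, if_neg hn.ne', pow_add,
      Complex.I_sq]
    simp

end Exponent

theorem levyExponentDeriv_zero (c s : ℝ) (ν : Measure ℝ) :
    levyExponentDeriv c s ν 0 = Complex.I * c := by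
  simp [levyExponentDeriv]

/-- `f` takes values in the discrete set `2πiℤ`, so its zero set is open and closed, and the line is
connected. -/
theorem eq_zero_of_exp_eq_one {f : ℝ → ℂ} (hf : Continuous f) (h0 : f 0 = 0)
    (h : ∀ u, Complex.exp (f u) = 1) (u : ℝ) : f u = 0 := by
  have hclopen : IsClopen {u | f u = 0} := by
    refine ⟨isClosed_eq hf continuous_const, isOpen_iff_mem_nhds.2 fun u hu => ?_⟩
    have hnorm : ∀ᶠ v in 𝓝 u, ‖f v‖ < 1 := by
      refine hf.norm.continuousAt.eventually_lt_const ?_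
      change ‖f u‖ < 1
      rw [show f u = 0 from hu, norm_zero]
      exact one_pos
    filter_upwards [hnorm] with v hv
    obtain ⟨n, hn⟩ := Complex.exp_eq_one_iff.1 (h v)
    have hn0 : n = 0 := by
      by_contra hne
      have h1 : (1 : ℝ) ≤ |(n : ℝ)| := by exact_mod_cast Int.one_le_abs hne
      have h2 : ‖f v‖ = |(n : ℝ)| * (2 * Real.pi) := by
        rw [hn]; simp [abs_of_pos Real.pi_pos]
      nlinarith [Real.pi_gt_three]
    change f v = 0
    rw [hn, hn0]
    simp
  have := hclopen.eq_univ ⟨0, h0⟩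
  exact (this ▸ Set.mem_univ u : u ∈ {u | f u = 0})

/-! ### Moments of the umbra of a triplet, and the comparison. -/

namespace Umbra

theorem moment_disjointSum (α γ : Umbra) {n : ℕ} (hn : n ≠ 0) :
    (disjointSum α γ).moment n = α.moment n + γ.moment n := by
  have : (n ! : ℝ) ≠ 0 := by positivity
  simp only [disjointSum, ofGenFun, map_sub, map_add, coeff_genFun, coeff_one, if_neg hn]
  field_simp
  ring

theorem moment_scale (c : ℝ) (α : Umbra) (n : ℕ) :
    (scale c α).moment n = c ^ n * α.moment n := by
  simp [scale, evaluation_X_pow]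

theorem moment_singleton_one : singleton.moment 1 = 1 := by
  simp [singleton, ofGenFun]

theorem moment_singleton_add_two (n : ℕ) : singleton.moment (n + 2) = 0 := by
  simp [singleton, ofGenFun, coeff_one, coeff_X]

theorem moment_delta_one : delta.moment 1 = 0 := by
  simp [delta, ofGenFun, coeff_one, coeff_X_pow]

theorem moment_delta_add_two (n : ℕ) : delta.moment (n + 2) = if n = 0 then 1 else 0 := by
  rcases eq_or_ne n 0 with rfl | hn
  · simp [delta, ofGenFun, coeff_one]
  · simp [delta, ofGenFun, coeff_one, coeff_X_pow, hn]

theorem moment_ofLevyMeasure_one (ν : Measure ℝ) : (ofLevyMeasure ν).moment 1 = 0 := by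
  simp [ofLevyMeasure, ofGenFun, levySeries, coeff_one]

theorem moment_ofLevyMeasure_add_two (ν : Measure ℝ) (n : ℕ) :
    (ofLevyMeasure ν).moment (n + 2) = ∫ x, x ^ (n + 2) ∂ν := by
  have h (x : ℝ) : coeff (n + 2) (rescale x (exp ℝ) - 1 - C x * X : ℝ⟦X⟧) =
      ((n + 2) ! : ℝ)⁻¹ * x ^ (n + 2) := by
    simp [coeff_one, coeff_X, mul_comm]
  have h0 : ((n + 2) ! : ℝ) ≠ 0 := by positivity
  simp only [ofLevyMeasure, ofGenFun, levySeries, map_add, coeff_mk, h, integral_const_mul]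
  simp [coeff_one, h0]

/-- The umbra `c χ ∔ s δ ∔ γ` attached to a Lévy triplet. -/
noncomputable def ofTriplet (c s : ℝ) (ν : Measure ℝ) : Umbra :=
  disjointSum (disjointSum (scale c singleton) (scale s delta)) (ofLevyMeasure ν)

theorem moment_ofTriplet_one (c s : ℝ) (ν : Measure ℝ) : (ofTriplet c s ν).moment 1 = c := by
  simp [ofTriplet, moment_disjointSum, moment_scale, moment_singleton_one, moment_delta_one,
    moment_ofLevyMeasure_one]

theorem moment_ofTriplet_add_two (c s : ℝ) (ν : Measure ℝ) (n : ℕ) :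
    (ofTriplet c s ν).moment (n + 2) =
      (if n = 0 then s ^ 2 else 0) + ∫ x, x ^ (n + 2) ∂ν := by
  rw [ofTriplet, moment_disjointSum _ _ (by omega), moment_disjointSum _ _ (by omega),
    moment_scale, moment_scale, moment_singleton_add_two, moment_delta_add_two,
    moment_ofLevyMeasure_add_two]
  rcases eq_or_ne n 0 with rfl | hn
  · simp
  · simp [hn]

end Umbra

/-- The derivatives at `0` of the exponent of a Lévy triplet are the moments of its umbra. -/
theorem iteratedDeriv_levyExponentDeriv {ν : Measure ℝ}
    (hmom : ∀ n : ℕ, 2 ≤ n → Integrable (fun x : ℝ => x ^ n) ν) (c s : ℝ) (n : ℕ) :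
    iteratedDeriv n (levyExponentDeriv c s ν) 0 =
      Complex.I ^ (n + 1) * ((Umbra.ofTriplet c s ν).moment (n + 1) : ℝ) := by
  cases n with
  | zero => simp [levyExponentDeriv_zero, Umbra.moment_ofTriplet_one]
  | succ n =>
    rw [iteratedDeriv_succ_levyExponentDeriv hmom, Umbra.moment_ofTriplet_add_two]

/-- A probability measure whose characteristic function is `exp (t Ψ)`, with `Ψ` the exponent of
a Lévy triplet, has the moments of the umbra `t . β . α`. -/
theorem moments_of_charFun_eq_exp_levyExponent {μ : Measure ℝ} [IsProbabilityMeasure μ]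
    {ν : Measure ℝ} (hmom : ∀ n : ℕ, 2 ≤ n → Integrable (fun x : ℝ => x ^ n) ν) {c s t : ℝ}
    (hμ : ∀ u, charFun μ u = Complex.exp (t * levyExponent c s ν u)) :
    (∀ n : ℕ, MemLp id n μ) ∧ ∀ k, ∫ x, x ^ k ∂μ =
      (Umbra.realDot t (Umbra.dot Umbra.bell (Umbra.ofTriplet c s ν))).moment k := by
  have hμ' : charFun μ = fun u => Complex.exp (t * levyExponent c s ν u) := funext hμ
  have hφ : ContDiff ℝ ∞ (charFun μ) := by
    rw [hμ']
    exact (contDiff_const.mul (contDiff_levyExponent hmom c s)).cexp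
  have hD := contDiff_levyExponentDeriv hmom c s
  have hmem := memLp_id_of_contDiff_charFun hφ
  have hderiv : deriv (charFun μ) =
      fun u => (t : ℂ) * (levyExponentDeriv c s ν u * charFun μ u) := by
    ext u
    have h := ((hasDerivAt_levyExponent c s (hmom 2 le_rfl) u).const_mul (t : ℂ)).cexp
    rw [← hμ'] at h
    rw [h.deriv, ← hμ u]
    ring
  refine ⟨hmem, fun k => ?_⟩
  induction k using Nat.strong_induction_on with
  | _ k ih =>
    cases k with
    | zero => simp [Umbra.moment_zero]
    | succ k =>
      rw [Umbra.moment_realDot_bell_dot_succ]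
      -- Leibniz' rule for `φ' = t Ψ' φ` at `0` gives the umbral recursion multiplied by `i^(k+1)`,
      -- which is then cancelled.
      have h1 := iteratedDeriv_charFun_zero (hmem (k + 1))
      rw [iteratedDeriv_succ', hderiv, iteratedDeriv_const_mul_field,
        iteratedDeriv_fun_mul (contDiff_infty.1 hD k).contDiffAt
          (contDiff_infty.1 hφ k).contDiffAt] at h1
      have h2 : ∀ i ∈ Finset.range (k + 1), (k.choose i : ℂ) *
          iteratedDeriv i (levyExponentDeriv c s ν) 0 * iteratedDeriv (k - i) (charFun μ) 0 =
          Complex.I ^ (k + 1) * ((k.choose i : ℝ) * (Umbra.ofTriplet c s ν).moment (i + 1) *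
            (Umbra.realDot t (Umbra.dot Umbra.bell (Umbra.ofTriplet c s ν))).moment (k - i) : ℝ) := by
        intro i hi
        have hik : i ≤ k := Nat.lt_succ_iff.1 (Finset.mem_range.1 hi)
        rw [iteratedDeriv_levyExponentDeriv hmom, iteratedDeriv_charFun_zero (hmem (k - i)),
          ih (k - i) (by omega)]
        have : Complex.I ^ (k + 1) = Complex.I ^ (i + 1) * Complex.I ^ (k - i) := by
          rw [← pow_add]; congr 1; omega
        rw [this]
        push_cast
        ring
      rw [Finset.sum_congr rfl h2, ← Finset.mul_sum, mul_left_comm] at h1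
      have h3 := mul_left_cancel₀ (pow_ne_zero _ Complex.I_ne_zero) h1
      rw [← Complex.ofReal_sum, ← Complex.ofReal_mul] at h3
      exact (Complex.ofReal_injective h3).symm

/-- On `|x| > 1` one has `|x| ≤ x²`, so the large jumps can be compensated too, at the price of
adding their mean to the drift. -/
theorem exponent_eq_levyExponent {ν : Measure ℝ}
    (h2 : Integrable (fun x : ℝ => x ^ 2) ν) (m s u : ℝ) :
    Complex.I * u * m - (s ^ 2 : ℝ) * u ^ 2 / 2 +
        ∫ x : ℝ, (Complex.exp (Complex.I * u * x) - 1 -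
          Complex.I * u * ({y : ℝ | |y| ≤ 1}.indicator (fun y => y) x : ℝ)) ∂ν =
      levyExponent (m + ∫ x in {x : ℝ | 1 < |x|}, x ∂ν) s ν u := by
  have hms : MeasurableSet {x : ℝ | 1 < |x|} := measurableSet_lt measurable_const (by fun_prop)
  have hi : Integrable (fun x => {x : ℝ | 1 < |x|}.indicator (fun x => x) x) ν := by
    refine h2.mono' (measurable_id.indicator hms).aestronglyMeasurable (ae_of_all _ fun x => ?_)
    by_cases hx : 1 < |x|
    · rw [Set.indicator_of_mem (by exact hx), Real.norm_eq_abs, ← sq_abs]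
      nlinarith
    · rw [Set.indicator_of_notMem (by exact hx), norm_zero]
      positivity
  have hsum (x : ℝ) : {y : ℝ | |y| ≤ 1}.indicator (fun y => y) x =
      x - {x : ℝ | 1 < |x|}.indicator (fun x => x) x := by
    by_cases hx : 1 < |x|
    · rw [Set.indicator_of_mem (s := {x : ℝ | 1 < |x|}) hx,
        Set.indicator_of_notMem (by exact not_le.2 hx), sub_self]
    · rw [Set.indicator_of_notMem (s := {x : ℝ | 1 < |x|}) hx,
        Set.indicator_of_mem (by exact not_lt.1 hx), sub_zero]
  have hi' : Integrable (fun x => Complex.I * u *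
      (({x : ℝ | 1 < |x|}.indicator (fun x => x) x : ℝ) : ℂ)) ν := hi.ofReal.const_mul _
  have hint : ∫ x : ℝ, (Complex.exp (Complex.I * u * x) - 1 -
          Complex.I * u * ({y : ℝ | |y| ≤ 1}.indicator (fun y => y) x : ℝ)) ∂ν =
      ∫ x : ℝ, (Complex.exp (Complex.I * u * x) - 1 - Complex.I * u * x) ∂ν +
        Complex.I * u * (∫ x in {x : ℝ | 1 < |x|}, x ∂ν : ℝ) := by
    rw [← integral_indicator hms, ← integral_complex_ofReal, ← integral_const_mul,
      ← integral_add (integrable_exp_sub_one_sub h2 u) hi']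
    congr with x
    rw [hsum]
    push_cast
    ring
  rw [hint, levyExponent]
  push_cast
  ring

/-- The characteristic functions of a Lévy process in terms of a Lévy triplet. -/
theorem IsLevyProcess.charFun_eq_exp_levyExponent {Ω : Type*} [MeasurableSpace Ω] {P : Measure Ω}
    [IsProbabilityMeasure P] {X : ℝ≥0 → Ω → ℝ} (hX : IsLevyProcess X P) {m s : ℝ} {ν : Measure ℝ}
    (hT : IsLevyTriplet X P m (s ^ 2) ν)
    (hmom : ∀ n : ℕ, 2 ≤ n → Integrable (fun x : ℝ => x ^ n) ν) (t : ℝ≥0) (u : ℝ) :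
    charFun (P.map (X t)) u = Complex.exp ((t : ℝ) *
      levyExponent (m + ∫ x in {x : ℝ | 1 < |x|}, x ∂ν) s ν u) := by
  obtain ⟨ψ, hψ, hψ0, hexp⟩ := hX.exists_exponent
  set c := m + ∫ x in {x : ℝ | 1 < |x|}, x ∂ν with hc
  -- At time `1` the triplet determines `ψ u` only modulo `2πi`, which is not enough for non-integer
  -- times; continuity and the value at `u = 0` remove the ambiguity.
  have hone (u : ℝ) : Complex.exp (ψ u - levyExponent c s ν u) = 1 := by
    have h1 := hexp 1 u
    rw [hT.charFun_eq u, exponent_eq_levyExponent (hmom 2 le_rfl), ← hc] at h1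
    rw [Complex.exp_sub, h1]
    simp
  have h0 : ψ 0 - levyExponent c s ν 0 = 0 := by simp [hψ0, levyExponent]
  have heq := eq_zero_of_exp_eq_one (hψ.sub (contDiff_levyExponent hmom c s).continuous) h0 hone u
  rw [hexp, sub_eq_zero.1 heq]

theorem theorem3p2 {Ω : Type*} [MeasurableSpace Ω] (P : Measure Ω) [IsProbabilityMeasure P]
    (X : ℝ≥0 → Ω → ℝ) (hX : IsLevyProcess X P) :
    (∃ (m s : ℝ) (ν : Measure ℝ), IsLevyTriplet X P m (s ^ 2) ν) ∧
    ∀ (m s : ℝ) (ν : Measure ℝ), IsLevyTriplet X P m (s ^ 2) ν →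
      (∀ n : ℕ, 2 ≤ n → Integrable (fun x : ℝ => x ^ n) ν) →
      ∀ c₀ : ℝ, c₀ = m + ∫ x in {x : ℝ | 1 < |x|}, x ∂ν →
        IsUmbrallyRepresentedBy X P fun t =>
          Umbra.realDot (t : ℝ) (Umbra.dot Umbra.bell
            (Umbra.disjointSum
              (Umbra.disjointSum (Umbra.scale c₀ Umbra.singleton) (Umbra.scale s Umbra.delta))
              (Umbra.ofLevyMeasure ν))) := by
  refine ⟨hX.exists_levyTriplet, fun m s ν hT hmom c₀ hc₀ t k => ?_⟩
  subst hc₀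
  have hXt := hX.measurable t
  have hp : IsProbabilityMeasure (P.map (X t)) :=
    Measure.isProbabilityMeasure_map hXt.aemeasurable
  obtain ⟨hmem, hint⟩ := moments_of_charFun_eq_exp_levyExponent hmom
    (hX.charFun_eq_exp_levyExponent hT hmom t)
  have hpow : AEStronglyMeasurable (fun x : ℝ => x ^ k) (P.map (X t)) := by fun_prop
  refine ⟨?_, ?_⟩
  · have h1 : Integrable (fun x : ℝ => x ^ k) (P.map (X t)) :=
      ((hmem k).integrable_norm_pow').mono hpow (ae_of_all _ fun x => by simp)
    exact (integrable_map_measure hpow hXt.aemeasurable).1 h1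
  · rw [Umbra.evaluation_X_pow, ← integral_map hXt.aemeasurable hpow]
    exact hint k
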